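/- Embed $\mathrm U(1)$ in $\mathrm U(3)$ as $\{\operatorname{diag}(t,t^{-1},1) : t\in\mathbb C,\ |t|=1\}$, let $$J=\begin{pmatrix}0&1&0\\-1&0&0\\0&0&1\end{pmatrix}\in \mathrm U(3),$$ and let $H_3=\langle \mathrm U(1),J\rangle\le \mathrm U(3)$ be the subgroup generated by $\mathrm U(1)$ and $J$. For a partition $\mu=(\mu_1\ge\mu_2\ge\mu_3\ge 0)$ let $V(\mu)$ be the irreducible representation of $\mathrm U(3)$ with highest weight $\mu$, and for a closed subgroup $H\le \mathrm U(3)$ let $\mathfrak m_\mu(H)$ be the multiplicity of the trivial representation of $H$ in the restriction $V(\mu)|_H$. For integers $z,b\ge 0$ let $\tau(z,b)\in\{0,\pm1\}$ be the number depending only on $z$ and $b$ modulo $4$ given by the table $$\begin{array}{c|cccc} z\backslash b&0&1&2&3\\ \hline 0&1&1&0&0\\ 1&1&0&-1&0\\ 2&0&-1&-1&0\\ 3&0&0&0&0\end{array}$$ (1) For all integers $a\ge b\ge 0$ and $k\ge 0$, with $z:=a-b$, $$\mathfrak m_{(a+k,b+k,k)}(\mathrm U(1))=\left\lceil \frac{(z+1)(b+1)}2\right\rceil,\qquad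 \mathfrak m_{(a+k,b+k,k)}(H_3)=\frac12\left(\left\lceil \frac{(z+1)(b+1)}2\right\rceil+\tau(z,b)\right).$$ (2) For every integer $m\ge 1$, as polynomials in $x_1,\dots,x_m$, $$\prod_{i=1}^m(1+x_i)(1+x_i^2)=\sum_{\lambda=(3^k,2^b,1^z)}\tau(z,b)\,S_\lambda(x_1,\dots,x_m),$$ $$\prod_{i=1}^m(1-x_i)(1+x_i^2)=\sum_{\lambda=(3^k,2^b,1^z)}(-1)^{|\lambda|}\,\tau(z,b)\,S_\lambda(x_1,\dots,x_m),$$ where both sums run over all partitions $\lambda$ with at most $m$ parts, all parts at most $3$, the integers $k,b,z\ge0$ are the numbers of parts of $\lambda$ equal to $3,2,1$ respectively, $|\lambda|=3k+2b+z$, and $S_\lambda(x_1,\dots,x_m)$ is the Schur polynomial of $\lambda$ in $m$ variables (the character of the irreducible representation of $\mathrm U(m)$ with highest weight $\lambda$). -/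

import Mathlib

noncomputable section

namespace SchurBranching

/-! ### Schur polynomials -/

/-- The alternant `det (x_i ^ (e_j))` in `m` variables. -/
def alternant (m : ℕ) (e : Fin m → ℕ) : MvPolynomial (Fin m) ℤ :=
  (Matrix.of fun i j : Fin m => (MvPolynomial.X i : MvPolynomial (Fin m) ℤ) ^ e j).det

/-- The substitution `x_i ↦ x_j`. -/
def identify {m : ℕ} (i j : Fin m) : MvPolynomial (Fin m) ℤ →ₐ[ℤ] MvPolynomial (Fin m) ℤ :=
  MvPolynomial.aeval fun k => if k = i then MvPolynomial.X j else MvPolynomial.X k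

lemma sub_dvd_iff {m : ℕ} (i j : Fin m) (f : MvPolynomial (Fin m) ℤ) :
    (MvPolynomial.X i - MvPolynomial.X j) ∣ f ↔ identify i j f = 0 := by
  constructor
  · rintro ⟨q, rfl⟩
    by_cases h : j = i <;> simp [identify, h]
  · intro hf
    have key : (Ideal.Quotient.mkₐ ℤ (Ideal.span {(MvPolynomial.X i - MvPolynomial.X j :
        MvPolynomial (Fin m) ℤ)})).comp (identify i j) = Ideal.Quotient.mkₐ ℤ _ := by
      ext k
      by_cases h : k = i
      · subst h
        simp only [identify, AlgHom.comp_apply, MvPolynomial.aeval_X, if_true,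
          Ideal.Quotient.mkₐ_eq_mk]
        exact (Ideal.Quotient.eq.mpr (Ideal.mem_span_singleton_self _)).symm
      · simp [identify, h]
    have := DFunLike.congr_fun key f
    rw [AlgHom.comp_apply, hf, map_zero] at this
    exact Ideal.mem_span_singleton.mp (Ideal.Quotient.eq_zero_iff_mem.mp this.symm)

lemma prime_X_sub_X {m : ℕ} {i j : Fin m} (h : i ≠ j) :
    Prime (MvPolynomial.X i - MvPolynomial.X j : MvPolynomial (Fin m) ℤ) := by
  refine ⟨fun h0 => h (MvPolynomial.X_injective (sub_eq_zero.mp h0)), fun hu => ?_,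
    fun a b hab => ?_⟩
  · have := (sub_dvd_iff i j 1).mp hu.dvd
    simp at this
  · rw [sub_dvd_iff, map_mul, mul_eq_zero] at hab
    rwa [sub_dvd_iff, sub_dvd_iff]

lemma alternant_rev (m : ℕ) :
    alternant m (fun j => (Fin.rev j : ℕ)) =
      ∏ p : (i : Fin m) × {j : Fin m // i < j},
        (MvPolynomial.X p.1 - MvPolynomial.X p.2.1) := by
  have h := Matrix.det_projVandermonde (1 : Fin m → MvPolynomial (Fin m) ℤ) MvPolynomial.X
  have h2 : alternant m (fun j => (Fin.rev j : ℕ)) =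
      (Matrix.projVandermonde (1 : Fin m → MvPolynomial (Fin m) ℤ) MvPolynomial.X).det := by
    unfold alternant
    congr 1
    ext1 i j
    simp [Matrix.projVandermonde_apply]
  rw [h2, h, Fintype.prod_sigma]
  refine Finset.prod_congr rfl fun i _ => ?_
  simp only [Pi.one_apply, one_mul]
  exact Finset.prod_subtype _ (by simp) (fun j => MvPolynomial.X i - MvPolynomial.X j)

lemma alternant_dvd (m : ℕ) (e : Fin m → ℕ) :
    alternant m (fun j => (Fin.rev j : ℕ)) ∣ alternant m e := by
  rw [alternant_rev]
  refine Fintype.prod_dvd_of_isRelPrime ?_ ?_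
  · rintro ⟨i, j, hij⟩ ⟨k, l, hkl⟩ hne
    refine ((prime_X_sub_X hij.ne).irreducible.isRelPrime_iff_not_dvd).mpr fun hd => hne ?_
    rw [sub_dvd_iff] at hd
    simp only [identify, map_sub, MvPolynomial.aeval_X, sub_eq_zero] at hd
    have : (if k = i then j else k) = (if l = i then j else l) := by
      apply MvPolynomial.X_injective (R := ℤ)
      rw [apply_ite MvPolynomial.X, apply_ite MvPolynomial.X]
      exact hd
    have : i = k ∧ j = l := by
      split_ifs at this <;> omega
    obtain ⟨rfl, rfl⟩ := this
    rfl
  · rintro ⟨i, j, hij⟩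
    rw [sub_dvd_iff, alternant, AlgHom.map_det]
    refine Matrix.det_zero_of_row_eq hij.ne ?_
    ext1 k
    simp [identify, hij.ne']

/-- The Schur polynomial `s_λ(x_1, …, x_m)` of a partition `λ` with at most `m` parts (padded with
zeros): the quotient of alternants `det (x_i ^ (λ_j + m - j)) / det (x_i ^ (m - j))`. The quotient
is exact and unique, see `schur_mul_alternant`. -/
def schur (m : ℕ) (lam : Fin m → ℕ) : MvPolynomial (Fin m) ℤ :=
  Classical.choose (alternant_dvd m fun j => lam j + (Fin.rev j : ℕ))

lemma schur_mul_alternant (m : ℕ) (lam : Fin m → ℕ) :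
    schur m lam * alternant m (fun j => (Fin.rev j : ℕ)) =
      alternant m fun j => lam j + (Fin.rev j : ℕ) := by
  rw [mul_comm]
  exact (Classical.choose_spec (alternant_dvd m fun j => lam j + (Fin.rev j : ℕ))).symm

/-- The partitions `λ ⊴ (c ^ m)`: non-increasing sequences of length `m` (padded with zeros)
with entries at most `c`. -/
def boxPartitions (c m : ℕ) : Finset (Fin m → ℕ) :=
  open Classical in (Fintype.piFinset fun _ : Fin m => Finset.range (c + 1)).filter Antitone

/-- The number of parts of `λ` equal to `v`. -/
def partCount {m : ℕ} (lam : Fin m → ℕ) (v : ℕ) : ℕ :=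
  (Finset.univ.filter fun i => lam i = v).card

/-! ### The irreducible representation of `U(n)` with highest weight `λ` -/

/-- The substitution `f ↦ f(X A)` on polynomial functions `f` on complex `n × n` matrices; the entry
`X_{ij}` is the variable indexed by `(i, j)`. -/
def translate {n : ℕ} (A : Matrix (Fin n) (Fin n) ℂ) :
    MvPolynomial (Fin n × Fin n) ℂ →ₐ[ℂ] MvPolynomial (Fin n × Fin n) ℂ :=
  MvPolynomial.aeval fun p => ∑ l, MvPolynomial.X (p.1, l) * MvPolynomial.C (A l p.2)

lemma translate_one {n : ℕ} :
    translate (1 : Matrix (Fin n) (Fin n) ℂ) = AlgHom.id ℂ (MvPolynomial (Fin n × Fin n) ℂ) := by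
  refine MvPolynomial.algHom_ext fun p => ?_
  simp [translate, Matrix.one_apply, apply_ite MvPolynomial.C]

lemma translate_mul {n : ℕ} (A B : Matrix (Fin n) (Fin n) ℂ) :
    translate (A * B) = (translate A).comp (translate B) := by
  refine MvPolynomial.algHom_ext fun p => ?_
  simp only [translate, MvPolynomial.aeval_X, AlgHom.comp_apply, map_sum, map_mul,
    Matrix.mul_apply, MvPolynomial.algHom_C, MvPolynomial.algebraMap_eq, Finset.mul_sum,
    Finset.sum_mul]
  rw [Finset.sum_comm]
  simp only [mul_assoc]

/-- `U(n)` acting on polynomial functions on complex `n × n` matrices by right translation,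
`(u · f)(X) = f(X u)`. -/
def translation (n : ℕ) :
    Representation ℂ (Matrix.unitaryGroup (Fin n) ℂ) (MvPolynomial (Fin n × Fin n) ℂ) where
  toFun u := (translate (u : Matrix (Fin n) (Fin n) ℂ)).toLinearMap
  map_one' := by
    rw [OneMemClass.coe_one, translate_one]
    rfl
  map_mul' u v := by
    rw [Submonoid.coe_mul, translate_mul]
    rfl

/-- The leading principal `d × d` minor of the generic `n × n` matrix. -/
def leadingMinor (n d : ℕ) (h : d ≤ n) : MvPolynomial (Fin n × Fin n) ℂ :=
  (Matrix.of fun i j : Fin d =>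
    (MvPolynomial.X (Fin.castLE h i, Fin.castLE h j) : MvPolynomial (Fin n × Fin n) ℂ)).det

/-- The highest weight vector `∏_d Δ_d ^ (λ_d - λ_{d+1})` (with `λ_{n+1} = 0`), where `Δ_d` is the
leading principal `d × d` minor. It is invariant under unitriangular upper matrices and has
weight `λ` under the diagonal torus. -/
def highestWeightVector (n : ℕ) (lam : Fin n → ℕ) : MvPolynomial (Fin n × Fin n) ℂ :=
  ∏ d : Fin n, leadingMinor n (d + 1) d.isLt ^
    (lam d - if h : (d : ℕ) + 1 < n then lam ⟨d + 1, h⟩ else 0)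

/-- `V(λ)`: the representation of `U(n)` generated by the highest weight vector of weight `λ`
(`λ` a partition with at most `n` parts, padded with zeros). -/
def irrep (n : ℕ) (lam : Fin n → ℕ) : Subrepresentation (translation n) where
  toSubmodule := Submodule.span ℂ
    (Set.range fun u => translation n u (highestWeightVector n lam))
  apply_mem_toSubmodule u v hv := by
    induction hv using Submodule.span_induction with
    | mem x hx =>
      obtain ⟨w, rfl⟩ := hx
      exact Submodule.subset_span ⟨u * w, by simp⟩
    | zero => simp
    | add x y _ _ hx hy => rw [map_add]; exact Submodule.add_mem _ hx hy
    | smul c x _ hx => rw [map_smul]; exact Submodule.smul_mem _ c hx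

/-- The multiplicity of the trivial representation of `H ≤ U(n)` in the restriction `V(λ)|_H`,
i.e. the dimension of the space of `H`-invariant vectors. -/
def trivialMultiplicity {n : ℕ} (lam : Fin n → ℕ)
    (H : Subgroup (Matrix.unitaryGroup (Fin n) ℂ)) : ℕ :=
  Module.finrank ℂ
    (Representation.invariants ((irrep n lam).toRepresentation.comp H.subtype))

/-! ### The subgroups `U(1)` and `H₃` of `U(3)` -/

/-- The embedding `t ↦ diag(t, t⁻¹, 1)` of the circle group in `U(3)`. -/
def circleEmbedding : Circle →* Matrix.unitaryGroup (Fin 3) ℂ where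
  toFun t := ⟨Matrix.diagonal ![(t : ℂ), ((t⁻¹ : Circle) : ℂ), 1], by
    rw [Matrix.mem_unitaryGroup_iff, Matrix.star_eq_conjTranspose, Matrix.diagonal_conjTranspose,
      Matrix.diagonal_mul_diagonal, ← Matrix.diagonal_one]
    congr 1
    ext i
    fin_cases i <;> simp [Complex.mul_conj, ← mul_inv]⟩
  map_one' := by
    apply Subtype.ext
    simp only [OneMemClass.coe_one, inv_one, ← Matrix.diagonal_one]
    congr 1
    ext i
    fin_cases i <;> simp
  map_mul' s t := by
    apply Subtype.ext
    simp only [Submonoid.coe_mul, Matrix.diagonal_mul_diagonal]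
    congr 1
    ext i
    fin_cases i <;> simp [mul_comm]

/-- `U(1) ≤ U(3)`. -/
def U1 : Subgroup (Matrix.unitaryGroup (Fin 3) ℂ) := circleEmbedding.range

/-- The element `J` of `U(3)`. -/
def J : Matrix.unitaryGroup (Fin 3) ℂ :=
  ⟨!![0, 1, 0; -1, 0, 0; 0, 0, 1], by
    rw [Matrix.mem_unitaryGroup_iff]
    ext i j
    fin_cases i <;> fin_cases j <;> simp [Matrix.mul_apply, Fin.sum_univ_three]⟩

/-- `H₃ = ⟨U(1), J⟩`. -/
def H3 : Subgroup (Matrix.unitaryGroup (Fin 3) ℂ) :=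
  Subgroup.closure ((U1 : Set (Matrix.unitaryGroup (Fin 3) ℂ)) ∪ {J})

/-- The table `τ(z, b)`, depending on `z` (row) and `b` (column) modulo `4`. -/
def tau (z b : ℕ) : ℤ :=
  !![1, 1, 0, 0;
     1, 0, -1, 0;
     0, -1, -1, 0;
     0, 0, 0, 0] (Fin.ofNat 4 z) (Fin.ofNat 4 b)

end SchurBranching

end

/-! The Schur expansions are a threefold dual Pieri rule. Multiplying an alternant by `∏ (1 + y
x_i)` adds vertical strips (`prod_mul_sum_alt`). Over `ℂ`, `1 + x² = (1 + ix)(1 - ix)`, so the rule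
is used with `y = i, -i, 1`, starting from the Vandermonde determinant. Partitions are recorded by
column heights, and strips become interlacing conditions on heights. After two factors the
coefficient depends only on the difference of the two heights and equals `chi` of it (`sum_I_pow`).
The third factor sums `chi` over a rectangle, which gives `tau` (`sum_chi_Icc`). The second
expansion follows from the first by `x ↦ -x`.

For the multiplicities, `V(μ)` is realised as `det ^ k` times forms of degree `z` in the first row
`x` and degree `b` in the minors `p` of the first two rows (`irrep_toSubmodule_eq`). A `U(n)`-stable
subspace is stable under all matrices (`translate_mem`). Isolating the lowest power of `t` under
`diag(1, t, t²)` shows that every nonzero stable subspace contains the highest weight vector.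
Orthogonal complements for the Fischer pairing then show that this vector generates the whole space
(`span_translate_eq`).

The relation `x₀p₀ + x₁p₁ + x₂p₂ = 0` makes the monomials without the factor `x₂p₂` a spanning set,
and leading exponents show that they are independent (`linearIndependent_stdMon`). They are weight
vectors for `U(1)`, and counting those of weight zero gives the ceiling (`card_stdZero_eq`). On
their span `J` is a signed permutation of order dividing two, so its fixed space has dimension half
of the number of monomials plus the trace (`two_mul_finrank_fixed`). The trace is a signed count of
fixed monomials and again equals `tau` (`sum_fixed_stdZero`). -/

namespace SchurBranching

/-! ### Alternants and multiplication by elementary symmetric functions -/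

section Pieri

variable {A : Type*} [CommRing A] {m : ℕ}

/-- The alternant `det (x_i ^ (e_j))` of a family of ring elements. -/
def alt (x : Fin m → A) (e : Fin m → ℕ) : A :=
  (Matrix.of fun i j : Fin m => x i ^ e j).det

/-- The exponent vector `λ + δ` with `δ = (m - 1, …, 1, 0)`. -/
def shifted (lam : Fin m → ℕ) : Fin m → ℕ := fun j => lam j + (Fin.rev j : ℕ)

lemma map_alternant (f : MvPolynomial (Fin m) ℤ →+* A) (e : Fin m → ℕ) :
    f (alternant m e) = alt (fun i => f (MvPolynomial.X i)) e := by
  rw [alternant, RingHom.map_det, alt]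
  congr 1
  ext i j
  simp

/-- In the Leibniz term of `σ`, the product is reindexed by `σ`. Choosing `y * x (σ i)` from the
factors with `i ∈ t` raises the exponents of the columns in `t` by one. -/
lemma prod_mul_alt (x : Fin m → A) (y : A) (e : Fin m → ℕ) :
    (∏ i, (1 + y * x i)) * alt x e =
      ∑ t : Finset (Fin m), y ^ t.card * alt x (fun j => e j + if j ∈ t then 1 else 0) := by
  simp only [alt, Matrix.det_apply', Finset.mul_sum]
  rw [Finset.sum_comm]
  refine Finset.sum_congr rfl fun σ _ => ?_
  rw [← Equiv.prod_comp σ (fun i => 1 + y * x i), Finset.prod_one_add, Finset.powerset_univ,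
    Finset.sum_mul]
  refine Finset.sum_congr rfl fun t _ => ?_
  simp only [Matrix.of_apply, pow_add, Finset.prod_mul_distrib, Finset.prod_const]
  have : ∏ i, x (σ i) ^ (if i ∈ t then 1 else 0) = ∏ i ∈ t, x (σ i) := by
    simp [pow_ite, Finset.prod_ite_mem]
  rw [this]
  ring

/-- Monotonicity can only fail where two neighbouring parts are equal and only the later one grows.
The shift by `δ` then makes the two exponents equal, so two columns coincide. -/
lemma alt_shifted_eq_zero (x : Fin m → A) {lam : Fin m → ℕ} (hlam : Antitone lam)
    (t : Finset (Fin m)) (h : ¬ Antitone fun j => lam j + if j ∈ t then 1 else 0) :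
    alt x (shifted fun j => lam j + if j ∈ t then 1 else 0) = 0 := by
  cases m with
  | zero => exact absurd (Subsingleton.antitone _) h
  | succ n =>
    rw [Fin.antitone_iff_succ_le] at h
    push Not at h
    obtain ⟨i, hi⟩ := h
    have h1 : lam i.succ ≤ lam i.castSucc := hlam (Fin.castSucc_lt_succ).le
    refine Matrix.det_zero_of_column_eq (i := i.castSucc) (j := i.succ)
      (Fin.castSucc_lt_succ).ne fun k => ?_
    simp only [Matrix.of_apply, shifted, Fin.val_rev, Fin.val_castSucc, Fin.val_succ]
    congr 1
    have := i.isLt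
    split_ifs at hi ⊢ <;> omega

lemma mem_boxPartitions {c : ℕ} {lam : Fin m → ℕ} :
    lam ∈ boxPartitions c m ↔ (∀ i, lam i ≤ c) ∧ Antitone lam := by
  simp [boxPartitions]

/-- The partitions `λ` in a box with `c` columns such that `μ / λ` is a vertical strip. -/
def stripBelow (c : ℕ) (mu : Fin m → ℕ) : Finset (Fin m → ℕ) :=
  open Classical in (boxPartitions c m).filter fun lam => ∀ i, lam i ≤ mu i ∧ mu i ≤ lam i + 1

lemma mem_stripBelow {c : ℕ} {lam mu : Fin m → ℕ} :
    lam ∈ stripBelow c mu ↔ ((∀ i, lam i ≤ c) ∧ Antitone lam) ∧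
      ∀ i, lam i ≤ mu i ∧ mu i ≤ lam i + 1 := by
  simp [stripBelow, mem_boxPartitions]

/-- The dual Pieri rule in terms of alternants: the surviving subsets `t` are exactly the vertical
strips that can be added to `lam`. -/
lemma prod_mul_alt_shifted (x : Fin m → A) (y : A) {c : ℕ} {lam : Fin m → ℕ}
    (hlam : lam ∈ boxPartitions c m) :
    (∏ i, (1 + y * x i)) * alt x (shifted lam) =
      open Classical in
      ∑ mu ∈ (boxPartitions (c + 1) m).filter (fun mu => lam ∈ stripBelow c mu),
        y ^ (∑ i, mu i - ∑ i, lam i) * alt x (shifted mu) := by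
  classical
  have hl := mem_boxPartitions.mp hlam
  rw [prod_mul_alt]
  have h0 : ∀ t : Finset (Fin m), (fun j => shifted lam j + if j ∈ t then 1 else 0) =
      shifted fun j => lam j + if j ∈ t then 1 else 0 := by
    intro t; funext j; simp only [shifted]; ring
  simp only [h0]
  rw [← Finset.sum_filter_of_ne
    (p := fun t : Finset (Fin m) => Antitone fun j => lam j + if j ∈ t then 1 else 0)]
  swap
  · intro t _ ht
    by_contra hn
    exact ht (by rw [alt_shifted_eq_zero x hl.2 t hn, mul_zero])
  refine Finset.sum_bij' (fun t _ => fun j => lam j + if j ∈ t then 1 else 0)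
    (fun mu _ => Finset.univ.filter fun j => lam j < mu j) ?_ ?_ ?_ ?_ ?_
  · intro t ht
    rw [Finset.mem_filter] at ht ⊢
    refine ⟨mem_boxPartitions.mpr ⟨fun i => ?_, ht.2⟩, mem_stripBelow.mpr ⟨hl, fun i => ?_⟩⟩
    · have := hl.1 i
      split_ifs <;> omega
    · split_ifs <;> omega
  · intro mu hmu
    rw [Finset.mem_filter, mem_boxPartitions, mem_stripBelow] at hmu
    rw [Finset.mem_filter]
    refine ⟨Finset.mem_univ _, ?_⟩
    convert hmu.1.2 using 1
    funext j
    have := hmu.2.2 j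
    simp only [Finset.mem_filter, Finset.mem_univ, true_and]
    split_ifs <;> omega
  · intro t _
    ext j
    simp only [Finset.mem_filter, Finset.mem_univ, true_and]
    split_ifs <;> simp_all
  · intro mu hmu
    rw [Finset.mem_filter, mem_boxPartitions, mem_stripBelow] at hmu
    funext j
    have := hmu.2.2 j
    simp only [Finset.mem_filter, Finset.mem_univ, true_and]
    split_ifs <;> omega
  · intro t _
    congr 2
    simp [Finset.sum_add_distrib]

/-- Multiplying a combination of alternants indexed by the partitions in a box with `c` columns by
`∏ (1 + y x_i)`. -/
lemma prod_mul_sum_alt (x : Fin m → A) (y : A) (c : ℕ) (C : (Fin m → ℕ) → A) :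
    (∏ i, (1 + y * x i)) * ∑ lam ∈ boxPartitions c m, C lam * alt x (shifted lam) =
      ∑ mu ∈ boxPartitions (c + 1) m,
        (∑ lam ∈ stripBelow c mu, C lam * y ^ (∑ i, mu i - ∑ i, lam i)) * alt x (shifted mu) := by
  classical
  rw [Finset.mul_sum]
  have h1 : ∀ lam ∈ boxPartitions c m, (∏ i, (1 + y * x i)) * (C lam * alt x (shifted lam)) =
      ∑ mu ∈ (boxPartitions (c + 1) m).filter (fun mu => lam ∈ stripBelow c mu),
        C lam * y ^ (∑ i, mu i - ∑ i, lam i) * alt x (shifted mu) := by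
    intro lam hlam
    rw [mul_left_comm, prod_mul_alt_shifted x y hlam, Finset.mul_sum]
    exact Finset.sum_congr rfl fun _ _ => by ring
  rw [Finset.sum_congr rfl h1]
  simp only [Finset.sum_mul]
  refine Finset.sum_comm' fun lam mu => ?_
  rw [Finset.mem_filter]
  constructor
  · rintro ⟨_, h2, h3⟩
    exact ⟨h3, h2⟩
  · rintro ⟨h2, h3⟩
    exact ⟨mem_boxPartitions.mpr (mem_stripBelow.mp h2).1, h3, h2⟩

end Pieri

/-! ### Column heights of a partition -/

section Heights

variable {m : ℕ}

/-- The height of the `v`-th column: the number of parts that are at least `v`. -/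
def height (lam : Fin m → ℕ) (v : ℕ) : ℕ := (Finset.univ.filter fun i => v ≤ lam i).card

lemma height_le (lam : Fin m → ℕ) (v : ℕ) : height lam v ≤ m :=
  (Finset.card_le_univ _).trans (Fintype.card_fin m).le

/-- The indices of parts at least `v` form an initial segment. This lets a partition be rebuilt from
its column heights. -/
lemma le_iff_lt_height {lam : Fin m → ℕ} (h : Antitone lam) (v : ℕ) (j : Fin m) :
    v ≤ lam j ↔ (j : ℕ) < height lam v := by
  constructor
  · intro hj
    have : Finset.Iic j ⊆ Finset.univ.filter fun i => v ≤ lam i := by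
      intro i hi
      simpa using hj.trans (h (Finset.mem_Iic.mp hi))
    have := Finset.card_le_card this
    rw [Fin.card_Iic] at this
    exact this
  · intro hj
    by_contra hn
    have : (Finset.univ.filter fun i => v ≤ lam i) ⊆ Finset.Iio j := by
      intro i hi
      rw [Finset.mem_Iio]
      by_contra hij
      exact hn (((Finset.mem_filter.mp hi).2).trans (h (not_lt.mp hij)))
    have := Finset.card_le_card this
    rw [Fin.card_Iio] at this
    unfold height at hj
    omega

lemma height_eq_of_iff {lam : Fin m → ℕ} {v n : ℕ} (hn : n ≤ m)
    (h : ∀ j : Fin m, v ≤ lam j ↔ (j : ℕ) < n) : height lam v = n := by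
  unfold height
  simp only [h]
  rw [Fin.card_filter_val_lt, min_eq_right hn]

lemma height_mono {lam mu : Fin m → ℕ} {v w : ℕ} (h : ∀ j, v ≤ lam j → w ≤ mu j) :
    height lam v ≤ height mu w :=
  Finset.card_le_card fun j hj => by
    simp only [Finset.mem_filter, Finset.mem_univ, true_and] at hj ⊢
    exact h j hj

lemma partCount_add_height (lam : Fin m → ℕ) (v : ℕ) :
    partCount lam v + height lam (v + 1) = height lam v := by
  unfold partCount height
  rw [← Finset.card_union_of_disjoint]
  · congr 1
    ext i
    simp only [Finset.mem_union, Finset.mem_filter, Finset.mem_univ, true_and]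
    omega
  · rw [Finset.disjoint_filter]
    intro i _ h
    omega

lemma sum_eq_sum_height {c : ℕ} {lam : Fin m → ℕ} (h : ∀ i, lam i ≤ c) :
    ∑ i, lam i = ∑ v ∈ Finset.range c, height lam (v + 1) := by
  simp only [height, Finset.card_filter]
  rw [Finset.sum_comm]
  refine Finset.sum_congr rfl fun i _ => ?_
  rw [← Finset.card_filter]
  have : (Finset.range c).filter (fun v => v + 1 ≤ lam i) = Finset.range (lam i) := by
    ext v
    have := h i
    simp only [Finset.mem_filter, Finset.mem_range]
    omega
  rw [this, Finset.card_range]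

/-- The sum over vertical strips below a partition with at most two columns. -/
lemma sum_stripBelow_one {A : Type*} [AddCommMonoid A] {mu : Fin m → ℕ}
    (hmu : mu ∈ boxPartitions 2 m) (F : ℕ → A) :
    ∑ lam ∈ stripBelow 1 mu, F (height lam 1) =
      ∑ r ∈ Finset.Icc (height mu 2) (height mu 1), F r := by
  rw [mem_boxPartitions] at hmu
  have hm := height_le mu 1
  refine Finset.sum_bij' (fun lam _ => height lam 1)
    (fun r _ => fun j => if (j : ℕ) < r then 1 else 0) ?_ ?_ ?_ ?_ (fun _ _ => rfl)
  · intro lam hlam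
    rw [mem_stripBelow] at hlam
    rw [Finset.mem_Icc]
    constructor <;> refine height_mono fun j hj => ?_ <;> have := hlam.2 j <;> omega
  · intro r hr
    rw [Finset.mem_Icc] at hr
    refine mem_stripBelow.mpr ⟨⟨fun i => ?_, fun i j hij => ?_⟩, fun i => ?_⟩
    · split_ifs <;> omega
    · have : (i : ℕ) ≤ j := hij
      dsimp only; split_ifs <;> omega
    · have h1 := le_iff_lt_height hmu.2 1 i
      have h2 := le_iff_lt_height hmu.2 2 i
      have h3 := hmu.1 i
      split_ifs <;> omega
  · intro lam hlam
    rw [mem_stripBelow] at hlam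
    funext j
    have h1 := le_iff_lt_height hlam.1.2 1 j
    have h3 := hlam.1.1 j
    split_ifs <;> omega
  · intro r hr
    rw [Finset.mem_Icc] at hr
    refine height_eq_of_iff (hr.2.trans hm) fun j => ?_
    split_ifs <;> omega

/-- The sum over vertical strips below a partition with at most three columns. -/
lemma sum_stripBelow_two {A : Type*} [AddCommMonoid A] {mu : Fin m → ℕ}
    (hmu : mu ∈ boxPartitions 3 m) (F : ℕ → ℕ → A) :
    ∑ lam ∈ stripBelow 2 mu, F (height lam 1) (height lam 2) =
      ∑ r ∈ Finset.Icc (height mu 2) (height mu 1) ×ˢ Finset.Icc (height mu 3) (height mu 2),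
        F r.1 r.2 := by
  rw [mem_boxPartitions] at hmu
  have hm := height_le mu 1
  refine Finset.sum_bij' (fun lam _ => (height lam 1, height lam 2))
    (fun r _ => fun j => (if (j : ℕ) < r.1 then 1 else 0) + if (j : ℕ) < r.2 then 1 else 0)
    ?_ ?_ ?_ ?_ (fun _ _ => rfl)
  · intro lam hlam
    rw [mem_stripBelow] at hlam
    simp only [Finset.mem_product, Finset.mem_Icc]
    refine ⟨⟨?_, ?_⟩, ?_, ?_⟩ <;> refine height_mono fun j hj => ?_ <;>
      have := hlam.2 j <;> omega
  · intro r hr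
    simp only [Finset.mem_product, Finset.mem_Icc] at hr
    refine mem_stripBelow.mpr ⟨⟨fun i => ?_, fun i j hij => ?_⟩, fun i => ?_⟩
    · split_ifs <;> omega
    · have : (i : ℕ) ≤ j := hij
      dsimp only; split_ifs <;> omega
    · have h1 := le_iff_lt_height hmu.2 1 i
      have h2 := le_iff_lt_height hmu.2 2 i
      have h4 := le_iff_lt_height hmu.2 3 i
      have h3 := hmu.1 i
      split_ifs <;> omega
  · intro lam hlam
    rw [mem_stripBelow] at hlam
    funext j
    have h1 := le_iff_lt_height hlam.1.2 1 j
    have h2 := le_iff_lt_height hlam.1.2 2 j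
    have h3 := hlam.1.1 j
    dsimp only; split_ifs <;> omega
  · intro r hr
    simp only [Finset.mem_product, Finset.mem_Icc] at hr
    refine Prod.ext (height_eq_of_iff (by omega) fun j => ?_)
      (height_eq_of_iff (by omega) fun j => ?_) <;> split_ifs <;> omega

end Heights

open MvPolynomial

/-! ### The expansions of `∏ (1 ± x_i) (1 + x_i²)` -/

/-- The coefficients `1, 0, -1, 0, …` of `1 / (1 + x²)`. -/
def chi (z : ℕ) : ℤ := if z % 4 = 0 then 1 else if z % 4 = 2 then -1 else 0

lemma chi_add_four_sum (n : ℕ) : chi n + chi (n + 1) + chi (n + 2) + chi (n + 3) = 0 := by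
  unfold chi
  split_ifs <;> omega

lemma tau_add_four_left (z b : ℕ) : tau (z + 4) b = tau z b := by
  have : Fin.ofNat 4 (z + 4) = Fin.ofNat 4 z := by ext; simp
  rw [tau, this, tau]

lemma tau_add_four_right (z b : ℕ) : tau z (b + 4) = tau z b := by
  have : Fin.ofNat 4 (b + 4) = Fin.ofNat 4 b := by ext; simp
  rw [tau, this, tau]

lemma eq_of_add_four {f g : ℕ → ℤ} (hf : ∀ n, f (n + 4) = f n) (hg : ∀ n, g (n + 4) = g n)
    (h : ∀ n < 4, f n = g n) (n : ℕ) : f n = g n := by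
  induction n using Nat.strong_induction_on with
  | _ n ih =>
    by_cases hn : n < 4
    · exact h n hn
    · obtain ⟨k, rfl⟩ := Nat.exists_eq_add_of_le' (not_lt.mp hn)
      rw [hf, hg, ih k (by omega)]

/-- Four consecutive values of `chi` cancel, so the sum has period four in each variable and sixteen
cases remain. -/
lemma sum_chi (z b : ℕ) :
    ∑ i ∈ Finset.range (z + 1), ∑ j ∈ Finset.range (b + 1), chi (i + j) = tau z b := by
  refine eq_of_add_four (f := fun z => ∑ i ∈ Finset.range (z + 1), ∑ j ∈ Finset.range (b + 1),
    chi (i + j)) (g := fun z => tau z b) (fun n => ?_) (fun n => tau_add_four_left n b)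
    (fun z hz => ?_) z
  · have h : ∑ j ∈ Finset.range (b + 1), chi (n + 1 + j) +
        ∑ j ∈ Finset.range (b + 1), chi (n + 1 + 1 + j) +
        ∑ j ∈ Finset.range (b + 1), chi (n + 1 + 1 + 1 + j) +
        ∑ j ∈ Finset.range (b + 1), chi (n + 1 + 1 + 1 + 1 + j) = 0 := by
      simp only [← Finset.sum_add_distrib]
      refine Finset.sum_eq_zero fun j _ => ?_
      rw [← chi_add_four_sum (n + 1 + j)]
      ring_nf
    rw [show n + 4 + 1 = n + 1 + 1 + 1 + 1 + 1 by ring]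
    simp only [Finset.sum_range_succ _ (n + 1), Finset.sum_range_succ _ (n + 1 + 1),
      Finset.sum_range_succ _ (n + 1 + 1 + 1), Finset.sum_range_succ _ (n + 1 + 1 + 1 + 1)]
    linarith
  · refine eq_of_add_four (f := fun b => ∑ i ∈ Finset.range (z + 1),
      ∑ j ∈ Finset.range (b + 1), chi (i + j)) (g := fun b => tau z b) (fun n => ?_)
      (fun n => tau_add_four_right z n) (fun b hb => ?_) b
    · refine Finset.sum_congr rfl fun i _ => ?_
      have := chi_add_four_sum (i + (n + 1))
      rw [show n + 4 + 1 = n + 1 + 1 + 1 + 1 + 1 by ring]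
      simp only [Finset.sum_range_succ _ (n + 1), Finset.sum_range_succ _ (n + 1 + 1),
        Finset.sum_range_succ _ (n + 1 + 1 + 1), Finset.sum_range_succ _ (n + 1 + 1 + 1 + 1)]
      simp only [add_assoc] at this ⊢
      norm_num at this ⊢
      linarith
    · interval_cases z <;> interval_cases b <;> decide

/-- Measuring both coordinates from the common endpoint `q`, upwards and downwards, turns their
difference into a sum `i + j`. -/
lemma sum_chi_Icc {p q r : ℕ} (hqr : r ≤ q) (hpq : q ≤ p) :
    ∑ s ∈ Finset.Icc q p ×ˢ Finset.Icc r q, chi (s.1 - s.2) = tau (p - q) (q - r) := by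
  rw [← sum_chi, ← Finset.sum_product']
  refine Finset.sum_bij' (fun s _ => (s.1 - q, q - s.2)) (fun s _ => (s.1 + q, q - s.2))
    ?_ ?_ ?_ ?_ ?_
  all_goals
    rintro ⟨s, t⟩ h
    simp only [Finset.mem_product, Finset.mem_Icc, Finset.mem_range, Prod.mk.injEq] at h ⊢
  any_goals omega
  congr 1
  omega

lemma sum_I_pow {p q : ℕ} (hpq : q ≤ p) :
    ∑ r ∈ Finset.Icc q p, Complex.I ^ r * (-Complex.I) ^ (p + q - r) = (chi (p - q) : ℂ) := by
  obtain ⟨z, rfl⟩ := Nat.exists_eq_add_of_le hpq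
  -- Apart from the constant `I ^ z`, the terms alternate in sign, so the sum vanishes for odd `z`
  -- and has one net term for even `z`.
  have h1 : ∀ r ∈ Finset.Icc q (q + z), Complex.I ^ r * (-Complex.I) ^ (q + z + q - r) =
      Complex.I ^ z * (-1) ^ (r - q + z) := by
    intro r hr
    rw [Finset.mem_Icc] at hr
    obtain ⟨s, rfl⟩ := Nat.exists_eq_add_of_le hr.1
    obtain ⟨t, rfl⟩ := Nat.exists_eq_add_of_le (Nat.le_of_add_le_add_left hr.2)
    rw [show q + (s + t) + q - (q + s) = q + t by omega,
      show q + s - q + (s + t) = 2 * s + t by omega,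
      neg_pow, pow_add (-1 : ℂ) (2 * s), pow_mul, neg_one_sq, one_pow, one_mul,
      mul_left_comm, ← pow_add, show q + s + (q + t) = 2 * q + (s + t) by ring, pow_add _ (2 * q),
      pow_mul, Complex.I_sq, pow_add]
    have : ((-1 : ℂ) ^ q) * (-1) ^ q = 1 := by rw [← mul_pow]; simp
    linear_combination (-1 : ℂ) ^ t * Complex.I ^ (s + t) * this
  rw [Finset.sum_congr rfl h1, ← Finset.mul_sum, ← Finset.Ico_succ_right_eq_Icc,
    Finset.sum_Ico_eq_sum_range, Nat.add_sub_cancel_left]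
  have h2 : ∑ i ∈ Finset.range (Order.succ (q + z) - q), (-1 : ℂ) ^ (q + i - q + z) =
      (-1) ^ z * ∑ i ∈ Finset.range (z + 1), (-1) ^ i := by
    rw [Finset.mul_sum, Order.succ_eq_add_one, show q + z + 1 - q = z + 1 by omega]
    refine Finset.sum_congr rfl fun i _ => ?_
    rw [Nat.add_sub_cancel_left, pow_add, mul_comm]
  rw [h2, neg_one_geom_sum]
  obtain ⟨k, rfl | rfl⟩ := Nat.even_or_odd' z
  · rw [if_neg (by simp [parity_simps]), pow_mul, pow_mul, Complex.I_sq]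
    unfold chi
    obtain ⟨l, rfl | rfl⟩ := Nat.even_or_odd' k
    · rw [if_pos (by omega)]; simp [pow_mul]
    · rw [if_neg (by omega), if_pos (by omega)]; simp [pow_mul, pow_add]
  · rw [if_pos (by simp [parity_simps]), chi, if_neg (by omega), if_neg (by omega)]
    simp

section

variable {m : ℕ}

lemma height_antitone (lam : Fin m → ℕ) {v w : ℕ} (h : v ≤ w) : height lam w ≤ height lam v :=
  height_mono fun _ hj => h.trans hj

lemma prod_one_add_I_mul_alt (x : Fin m → MvPolynomial (Fin m) ℂ) :
    (∏ i, (1 + C Complex.I * x i)) * alt x (shifted 0) =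
      ∑ mu ∈ boxPartitions 1 m, C (Complex.I ^ height mu 1) * alt x (shifted mu) := by
  have h0 : boxPartitions 0 m = {0} := by
    ext lam
    simp only [mem_boxPartitions, Nat.le_zero, Finset.mem_singleton]
    exact ⟨fun h => funext h.1, fun h => by subst h; exact ⟨fun _ => rfl, antitone_const⟩⟩
  have := prod_mul_sum_alt x (C Complex.I) 0 1
  rw [h0, Finset.sum_singleton, Pi.one_apply, one_mul] at this
  rw [this]
  refine Finset.sum_congr rfl fun mu hmu => ?_
  rw [mem_boxPartitions] at hmu
  have h1 : stripBelow 0 mu = {0} := by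
    ext lam
    rw [mem_stripBelow, ← mem_boxPartitions, h0, Finset.mem_singleton]
    exact ⟨fun h => h.1, fun h => ⟨h, fun i => by subst h; simpa using hmu.1 i⟩⟩
  rw [h1, Finset.sum_singleton, sum_eq_sum_height hmu.1]
  simp

lemma prod_one_add_sq_mul_alt (x : Fin m → MvPolynomial (Fin m) ℂ) :
    (∏ i, (1 + x i ^ 2)) * alt x (shifted 0) =
      ∑ mu ∈ boxPartitions 2 m, C (chi (height mu 1 - height mu 2) : ℂ) * alt x (shifted mu) := by
  have hI : (C Complex.I : MvPolynomial (Fin m) ℂ) ^ 2 = -1 := by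
    rw [← C_pow, Complex.I_sq, C_neg, C_1]
  have h0 : ∏ i, (1 + x i ^ 2) =
      (∏ i, (1 + C (-Complex.I) * x i)) * ∏ i, (1 + C Complex.I * x i) := by
    rw [← Finset.prod_mul_distrib]
    refine Finset.prod_congr rfl fun i _ => ?_
    rw [C_neg]
    linear_combination x i ^ 2 * hI
  rw [h0, mul_assoc, prod_one_add_I_mul_alt, prod_mul_sum_alt]
  refine Finset.sum_congr rfl fun mu hmu => ?_
  congr 1
  rw [← sum_I_pow (height_antitone mu one_le_two), map_sum, ← sum_stripBelow_one hmu
    (fun r => C (Complex.I ^ r * (-Complex.I) ^ (height mu 1 + height mu 2 - r)))]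
  rw [mem_boxPartitions] at hmu
  refine Finset.sum_congr rfl fun lam hlam => ?_
  rw [mem_stripBelow] at hlam
  rw [sum_eq_sum_height hmu.1, sum_eq_sum_height hlam.1.1]
  simp [Finset.sum_range_succ]

/-- The last Pieri step has `y = 1`, so no power of `y` remains. The two heights below `mu`
interlace its three heights, and `sum_chi_Icc` evaluates the sum. -/
lemma prod_mul_alt_eq_sum_tau (x : Fin m → MvPolynomial (Fin m) ℂ) :
    (∏ i, (1 + x i) * (1 + x i ^ 2)) * alt x (shifted 0) =
      ∑ mu ∈ boxPartitions 3 m,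
        C (tau (partCount mu 1) (partCount mu 2) : ℂ) * alt x (shifted mu) := by
  have := prod_mul_sum_alt x 1 2 (fun mu => C (chi (height mu 1 - height mu 2) : ℂ))
  rw [← prod_one_add_sq_mul_alt, ← mul_assoc, ← Finset.prod_mul_distrib] at this
  simp only [one_mul, one_pow, mul_one] at this
  rw [this]
  refine Finset.sum_congr rfl fun mu hmu => ?_
  congr 1
  have h1 : _ + height mu 2 = _ := partCount_add_height mu 1
  have h2 : _ + height mu 3 = _ := partCount_add_height mu 2
  rw [sum_stripBelow_two hmu (fun p q => C (chi (p - q) : ℂ)), ← map_sum, ← Int.cast_sum,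
    sum_chi_Icc (height_antitone mu (by norm_num)) (height_antitone mu (by norm_num))]
  congr 3 <;> omega

lemma alternant_rev_ne_zero (m : ℕ) : alternant m (fun j => (Fin.rev j : ℕ)) ≠ 0 := by
  rw [alternant_rev]
  exact Finset.prod_ne_zero_iff.mpr fun p _ => (prime_X_sub_X p.2.2.ne).ne_zero

theorem prod_eq_sum_schur (m : ℕ) :
    ∏ i : Fin m, (1 + X i) * (1 + X i ^ 2) =
      ∑ lam ∈ boxPartitions 3 m, C (tau (partCount lam 1) (partCount lam 2)) * schur m lam := by
  -- Multiplying by the Vandermonde determinant turns Schur polynomials into alternants; passing to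
  -- `ℂ` makes `1 + x²` split.
  refine mul_right_cancel₀ (alternant_rev_ne_zero m)
    (map_injective (Int.castRingHom ℂ) (RingHom.injective_int _) ?_)
  have h0 : (fun j : Fin m => (Fin.rev j : ℕ)) = shifted 0 := by
    funext j; simp [shifted]
  rw [Finset.sum_mul]
  simp only [mul_assoc, schur_mul_alternant]
  simp only [map_sum, map_mul, map_prod, map_add, map_one, map_pow, map_X, map_C, map_alternant,
    h0]
  exact prod_mul_alt_eq_sum_tau X

/-- The substitution `x_i ↦ -x_i`. -/
noncomputable def negVars (m : ℕ) : MvPolynomial (Fin m) ℤ →ₐ[ℤ] MvPolynomial (Fin m) ℤ :=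
  aeval fun i => -X i

lemma negVars_alternant (e : Fin m → ℕ) :
    negVars m (alternant m e) = (-1) ^ (∑ i, e i) * alternant m e := by
  have : (negVars m : MvPolynomial (Fin m) ℤ →+* MvPolynomial (Fin m) ℤ) (alternant m e) =
      (-1) ^ (∑ i, e i) * alternant m e := by
    rw [map_alternant, alternant, ← Finset.prod_pow_eq_pow_sum, ← Matrix.det_mul_row]
    unfold alt
    congr 1
    ext1 i j
    simp [negVars, neg_pow (X i : MvPolynomial (Fin m) ℤ)]
  exact this

lemma negVars_schur (lam : Fin m → ℕ) :
    negVars m (schur m lam) = (-1) ^ (∑ i, lam i) * schur m lam := by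
  have h1 := congrArg (negVars m) (schur_mul_alternant m lam)
  rw [map_mul, negVars_alternant, negVars_alternant, Finset.sum_add_distrib,
    ← schur_mul_alternant, pow_add] at h1
  refine mul_right_cancel₀ (mul_ne_zero (pow_ne_zero (∑ i : Fin m, (Fin.rev i : ℕ))
    (neg_ne_zero.mpr one_ne_zero)) (alternant_rev_ne_zero m)) ?_
  rw [h1]
  ring

theorem prod_eq_sum_schur_neg (m : ℕ) :
    ∏ i : Fin m, (1 - X i) * (1 + X i ^ 2) =
      ∑ lam ∈ boxPartitions 3 m,
        C ((-1) ^ (∑ i, lam i) * tau (partCount lam 1) (partCount lam 2)) * schur m lam := by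
  have h := congrArg (negVars m) (prod_eq_sum_schur m)
  rw [map_prod, map_sum] at h
  convert h using 1
  · refine Finset.prod_congr rfl fun i _ => ?_
    simp [negVars, sub_eq_add_neg]
  · refine Finset.sum_congr rfl fun lam _ => ?_
    rw [map_mul (negVars m), negVars_schur, algHom_C, algebraMap_eq, C_mul, C_pow, C_neg, C_1]
    ring

end

/-! ### Submodules stable under the unitary group -/

section Stable

/-- A linear functional vanishing on `N` but not on the coefficient would turn `q` into a nonzero
complex polynomial with infinitely many roots. -/
lemma coeff_mem_of_eval_mem {σ : Type*} (N : Submodule ℂ (MvPolynomial σ ℂ))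
    (q : Polynomial (MvPolynomial σ ℂ)) {S : Set ℂ} (hS : S.Infinite)
    (h : ∀ t ∈ S, q.eval (C t) ∈ N) (n : ℕ) : q.coeff n ∈ N := by
  by_contra hn
  obtain ⟨l, hl, hN⟩ := Submodule.exists_le_ker_of_notMem hn
  set r : Polynomial ℂ :=
    ∑ i ∈ Finset.range (q.natDegree + 1), Polynomial.monomial i (l (q.coeff i)) with hr
  have h1 : ∀ t, r.eval t = l (q.eval (C t)) := by
    intro t
    rw [hr, Polynomial.eval_finsetSum, Polynomial.eval_eq_sum_range, map_sum]
    refine Finset.sum_congr rfl fun i _ => ?_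
    rw [Polynomial.eval_monomial, ← C_pow, mul_comm (q.coeff i), C_mul', map_smul, smul_eq_mul,
      mul_comm]
  have h2 : r = 0 := Polynomial.eq_zero_of_infinite_isRoot _ <| hS.mono fun t ht => by
    rw [Set.mem_ofPred_eq, Polynomial.IsRoot.def, h1]
    exact LinearMap.mem_ker.mp (hN (h t ht))
  have h3 : r.coeff n = l (q.coeff n) := by
    simp only [hr, Polynomial.finsetSum_coeff, Polynomial.coeff_monomial, Finset.sum_ite_eq',
      Finset.mem_range]
    split_ifs with hlt
    · rfl
    · rw [Polynomial.coeff_eq_zero_of_natDegree_lt (by omega), map_zero]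
  exact hl (by rw [← h3, h2, Polynomial.coeff_zero])

lemma eval_mem_of_coeff_mem {σ : Type*} (N : Submodule ℂ (MvPolynomial σ ℂ))
    (q : Polynomial (MvPolynomial σ ℂ)) (h : ∀ n, q.coeff n ∈ N) (t : ℂ) : q.eval (C t) ∈ N := by
  rw [Polynomial.eval_eq_sum_range]
  refine N.sum_mem fun i _ => ?_
  rw [← C_pow, mul_comm, C_mul']
  exact N.smul_mem _ (h i)

variable {n : ℕ}

lemma exists_polynomial_translate (A B : Matrix (Fin n) (Fin n) ℂ)
    (f : MvPolynomial (Fin n × Fin n) ℂ) :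
    ∃ q : Polynomial (MvPolynomial (Fin n × Fin n) ℂ),
      ∀ t : ℂ, translate (A + t • B) f = q.eval (C t) := by
  refine ⟨aeval (fun p : Fin n × Fin n => ∑ l, Polynomial.C (X (p.1, l)) *
    (Polynomial.C (C (A l p.2)) + Polynomial.X * Polynomial.C (C (B l p.2)))) f, fun t => ?_⟩
  have : (translate (A + t • B) : MvPolynomial (Fin n × Fin n) ℂ →+* _) =
      (Polynomial.evalRingHom (C t)).comp (aeval (fun p : Fin n × Fin n =>
        ∑ l, Polynomial.C (X (p.1, l) : MvPolynomial (Fin n × Fin n) ℂ) *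
    (Polynomial.C (C (A l p.2)) + Polynomial.X * Polynomial.C (C (B l p.2)))) :
      MvPolynomial (Fin n × Fin n) ℂ →ₐ[ℂ] _).toRingHom := by
    refine MvPolynomial.ringHom_ext (fun c => ?_) (fun p => ?_)
    · simp [translate, algebraMap_eq, IsScalarTower.algebraMap_apply ℂ
        (MvPolynomial (Fin n × Fin n) ℂ) (Polynomial (MvPolynomial (Fin n × Fin n) ℂ))]
    · simp [translate, Polynomial.eval_finsetSum, mul_comm (C t)]
  exact DFunLike.congr_fun this f

lemma translate_mem_of_infinite (N : Submodule ℂ (MvPolynomial (Fin n × Fin n) ℂ))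
    (A B : Matrix (Fin n) (Fin n) ℂ) {S : Set ℂ} (hS : S.Infinite)
    (h : ∀ t ∈ S, ∀ f ∈ N, translate (A + t • B) f ∈ N) (t : ℂ) :
    ∀ f ∈ N, translate (A + t • B) f ∈ N := by
  intro f hf
  obtain ⟨q, hq⟩ := exists_polynomial_translate A B f
  rw [hq]
  refine eval_mem_of_coeff_mem N q (coeff_mem_of_eval_mem N q hS fun s hs => ?_) t
  rw [← hq]
  exact h s hs f hf

variable {N : Submodule ℂ (MvPolynomial (Fin n × Fin n) ℂ)}

lemma infinite_unit_sphere : (Metric.sphere (0 : ℂ) 1).Infinite := by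
  refine (isPreconnected_sphere (by simp [Complex.rank_real_complex]) 0 1).infinite_of_nontrivial
    ⟨1, by simp, -1, by simp, ?_⟩
  norm_num [Complex.ext_iff]

lemma translate_diagonal_mem
    (hN : ∀ u : Matrix.unitaryGroup (Fin n) ℂ, ∀ f ∈ N, translate u f ∈ N) (d : Fin n → ℂ) :
    ∀ f ∈ N, translate (Matrix.diagonal d) f ∈ N := by
  -- The entries indexed by `s` are already arbitrary; the others lie on the unit circle and are
  -- released one at a time.
  suffices h : ∀ s : Finset (Fin n), ∀ d : Fin n → ℂ, (∀ i ∉ s, ‖d i‖ = 1) →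
      ∀ f ∈ N, translate (Matrix.diagonal d) f ∈ N from
    h Finset.univ d fun i hi => absurd (Finset.mem_univ i) hi
  intro s
  induction s using Finset.induction_on with
  | empty =>
    intro d hd
    refine hN ⟨Matrix.diagonal d, ?_⟩
    rw [Matrix.mem_unitaryGroup_iff, Matrix.star_eq_conjTranspose,
      Matrix.diagonal_conjTranspose, Matrix.diagonal_mul_diagonal, ← Matrix.diagonal_one]
    congr 1
    ext i
    simp [Complex.mul_conj, Complex.normSq_eq_norm_sq, hd i (Finset.notMem_empty i)]
  | insert i s his ih =>
    intro d hd
    have key : ∀ t : ℂ, Matrix.diagonal (Function.update d i 0) +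
        t • Matrix.diagonal (Pi.single i (1 : ℂ)) = Matrix.diagonal (Function.update d i t) := by
      intro t
      rw [← Matrix.diagonal_smul, Matrix.diagonal_add]
      congr 1
      ext j
      by_cases h : j = i
      · subst h; simp
      · simp [h]
    have := translate_mem_of_infinite N (Matrix.diagonal (Function.update d i 0))
      (Matrix.diagonal (Pi.single i (1 : ℂ))) (S := Metric.sphere (0 : ℂ) 1)
      infinite_unit_sphere (fun t ht => ?_) (d i)
    · rwa [key, Function.update_eq_self] at this
    · rw [key]
      refine ih _ fun j hj => ?_
      by_cases h : j = i
      · subst h; simpa using ht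
      · rw [Function.update_of_ne h]
        exact hd j (by simp [h, hj])

lemma translate_isHermitian_mem
    (hN : ∀ u : Matrix.unitaryGroup (Fin n) ℂ, ∀ f ∈ N, translate u f ∈ N)
    {A : Matrix (Fin n) (Fin n) ℂ} (hA : A.IsHermitian) :
    ∀ f ∈ N, translate A f ∈ N := by
  intro f hf
  have h := hA.spectral_theorem
  rw [Unitary.conjStarAlgAut_apply] at h
  rw [h, translate_mul, translate_mul]
  exact hN hA.eigenvectorUnitary _
    (translate_diagonal_mem hN _ _ (hN (star hA.eigenvectorUnitary) f hf))

/-- A subspace stable under `U(n)` is stable under all complex matrices. -/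
theorem translate_mem
    (hN : ∀ u : Matrix.unitaryGroup (Fin n) ℂ, ∀ f ∈ N, translate u f ∈ N)
    (A : Matrix (Fin n) (Fin n) ℂ) : ∀ f ∈ N, translate A f ∈ N := by
  rw [← realPart_add_I_smul_imaginaryPart A]
  -- For real `t`, the real part plus `t` times the imaginary part is Hermitian; the given matrix is
  -- the value at `t = I`.
  refine translate_mem_of_infinite N _ _ (S := Set.range ((↑) : ℝ → ℂ))
    (Set.infinite_range_of_injective Complex.ofReal_injective) ?_ _
  rintro _ ⟨t, rfl⟩
  refine translate_isHermitian_mem hN ?_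
  have h1 : IsSelfAdjoint (realPart A : Matrix (Fin n) (Fin n) ℂ) := (realPart A).2
  have h2 : IsSelfAdjoint (imaginaryPart A : Matrix (Fin n) (Fin n) ℂ) := (imaginaryPart A).2
  exact h1.add (IsSelfAdjoint.smul (Complex.conj_ofReal t) h2)

end Stable

/-! ### The Fischer pairing -/

section Fischer

variable {σ : Type*}

/-- The bilinear pairing of polynomials in which distinct monomials are orthogonal and `x ^ m` has
square `m!`. -/
noncomputable def fischer : MvPolynomial σ ℂ →ₗ[ℂ] MvPolynomial σ ℂ →ₗ[ℂ] ℂ :=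
  (basisMonomials σ ℂ).constr ℂ fun m => ((m.prod fun _ k => k.factorial : ℕ) : ℂ) • lcoeff ℂ m

lemma fischer_monomial (m : σ →₀ ℕ) (c : ℂ) (g : MvPolynomial σ ℂ) :
    fischer (monomial m c) g = c * ((m.prod fun _ k => k.factorial : ℕ) : ℂ) * coeff m g := by
  have h : monomial m c = c • basisMonomials σ ℂ m := by
    rw [coe_basisMonomials, smul_monomial, smul_eq_mul, mul_one]
  rw [h, map_smul, fischer, Module.Basis.constr_basis]
  simp [mul_assoc]

lemma fischer_C (c : ℂ) (g : MvPolynomial σ ℂ) : fischer (C c) g = c * coeff 0 g := by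
  rw [← monomial_zero', fischer_monomial]
  simp

lemma factorial_prod_add_single (m : σ →₀ ℕ) (p : σ) :
    ((m + Finsupp.single p 1).prod fun _ k => k.factorial) =
      (m p + 1) * m.prod fun _ k => k.factorial := by
  classical
  rw [← Finsupp.mul_prod_erase' (m + Finsupp.single p 1) p _ (fun _ => rfl),
    ← Finsupp.mul_prod_erase' m p _ (fun _ => rfl)]
  have : (m + Finsupp.single p 1).erase p = m.erase p := by
    ext q
    by_cases h : q = p
    · subst h; simp
    · simp [Finsupp.erase_ne h]
  rw [this]
  simp [Nat.factorial_succ, mul_assoc]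

/-- The factorial weights are chosen to make multiplication by a variable adjoint to
differentiation. -/
lemma fischer_mul_X (f g : MvPolynomial σ ℂ) (p : σ) :
    fischer (f * X p) g = fischer f (pderiv p g) := by
  induction f using MvPolynomial.induction_on' with
  | add f₁ f₂ h₁ h₂ => rw [add_mul, map_add, map_add, LinearMap.add_apply, LinearMap.add_apply, h₁,
      h₂]
  | monomial m c =>
    rw [X, monomial_mul, mul_one, fischer_monomial, fischer_monomial, coeff_pderiv,
      factorial_prod_add_single]
    push_cast
    ring

/-- The pairing of `g` with its conjugate is a sum of squared absolute values of coefficients with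
positive weights. -/
lemma fischer_map_star_self (g : MvPolynomial σ ℂ) (h : fischer (map (starRingEnd ℂ) g) g = 0) :
    g = 0 := by
  have h1 : fischer (map (starRingEnd ℂ) g) g = ((∑ m ∈ g.support,
      ((m.prod fun _ k => k.factorial : ℕ) : ℝ) * Complex.normSq (coeff m g) : ℝ) : ℂ) := by
    conv_lhs => enter [1]; rw [← support_sum_monomial_coeff g]
    rw [map_sum, map_sum, LinearMap.sum_apply, Complex.ofReal_sum]
    refine Finset.sum_congr rfl fun m _ => ?_
    rw [map_monomial, fischer_monomial, Complex.ofReal_mul, Complex.normSq_eq_conj_mul_self,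
      Complex.ofReal_natCast]
    ring
  rw [h1, Complex.ofReal_eq_zero, Finset.sum_eq_zero_iff_of_nonneg fun m _ =>
    mul_nonneg (Nat.cast_nonneg _) (Complex.normSq_nonneg _)] at h
  ext m
  by_contra hm
  have h2 := h m (mem_support_iff.mpr hm)
  rw [mul_eq_zero, Complex.normSq_eq_zero, Nat.cast_eq_zero, Finsupp.prod,
    Finset.prod_eq_zero_iff] at h2
  rcases h2 with ⟨p, _, hp⟩ | h2
  · exact Nat.factorial_ne_zero _ hp
  · exact hm h2

variable {n : ℕ}

lemma pderiv_translate (A : Matrix (Fin n) (Fin n) ℂ) (i j : Fin n)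
    (g : MvPolynomial (Fin n × Fin n) ℂ) :
    pderiv (i, j) (translate A g) = ∑ l, C (A j l) * translate A (pderiv (i, l) g) := by
  induction g using MvPolynomial.induction_on with
  | C c => simp [translate, algebraMap_eq]
  | add f₁ f₂ h₁ h₂ => simp only [map_add, h₁, h₂, mul_add, Finset.sum_add_distrib]
  | mul_X f p h =>
    obtain ⟨k, q⟩ := p
    have hX : pderiv (i, j) (translate A (X (k, q))) =
        if k = i then C (A j q) else 0 := by
      simp only [translate, aeval_X, map_sum, pderiv_mul, pderiv_C, mul_zero, add_zero, pderiv_X,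
        Pi.single_apply, Prod.mk.injEq]
      split_ifs with hk
      · subst hk
        simp [eq_comm]
      · simp [hk]
    have hX' : ∀ l, pderiv (i, l) (X (k, q) : MvPolynomial (Fin n × Fin n) ℂ) =
        if k = i ∧ q = l then 1 else 0 := by
      intro l
      simp only [pderiv_X, Pi.single_apply, Prod.mk.injEq, eq_comm]
    rw [map_mul, pderiv_mul, h, hX]
    simp only [pderiv_mul, map_add, map_mul, hX', mul_add, Finset.sum_add_distrib, Finset.sum_mul,
      mul_assoc]
    congr 1
    by_cases hk : k = i
    · subst hk
      simp [apply_ite (translate A), mul_comm]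
    · simp [hk]

lemma coeff_zero_translate (A : Matrix (Fin n) (Fin n) ℂ) (g : MvPolynomial (Fin n × Fin n) ℂ) :
    coeff 0 (translate A g) = coeff 0 g := by
  have : (constantCoeff : MvPolynomial (Fin n × Fin n) ℂ →+* ℂ).comp
      (translate A : MvPolynomial (Fin n × Fin n) ℂ →+* _) = constantCoeff := by
    refine MvPolynomial.ringHom_ext (fun c => ?_) (fun p => ?_) <;> simp [translate, algebraMap_eq]
  exact DFunLike.congr_fun this g

/-- Translation by `A` is adjoint to translation by the transpose of `A`. -/
theorem fischer_translate (A : Matrix (Fin n) (Fin n) ℂ) (f g : MvPolynomial (Fin n × Fin n) ℂ) :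
    fischer (translate A f) g = fischer f (translate A.transpose g) := by
  induction f using MvPolynomial.induction_on generalizing g with
  | C c => simp [translate, algebraMap_eq, fischer_C, ← coeff_zero_translate A.transpose g]
  | add f₁ f₂ h₁ h₂ => simp only [map_add, LinearMap.add_apply, h₁, h₂]
  | mul_X f p h =>
    obtain ⟨i, j⟩ := p
    rw [fischer_mul_X, pderiv_translate, map_mul, map_sum]
    have : translate A (X (i, j)) = ∑ l, A l j • X (i, l) := by
      simp only [translate, aeval_X, smul_eq_C_mul, mul_comm]
    simp only [this, Finset.mul_sum, mul_smul_comm, map_sum, map_smul, LinearMap.sum_apply,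
      LinearMap.smul_apply, fischer_mul_X, h, C_mul', Matrix.transpose_apply]

lemma map_star_translate (A : Matrix (Fin n) (Fin n) ℂ) (f : MvPolynomial (Fin n × Fin n) ℂ) :
    map (starRingEnd ℂ) (translate A f) =
      translate (A.map (starRingEnd ℂ)) (map (starRingEnd ℂ) f) := by
  have : (map (starRingEnd ℂ)).comp (translate A : MvPolynomial (Fin n × Fin n) ℂ →+* _) =
      (translate (A.map (starRingEnd ℂ)) : MvPolynomial (Fin n × Fin n) ℂ →+*
        MvPolynomial (Fin n × Fin n) ℂ).comp
        (map (starRingEnd ℂ)) := by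
    refine MvPolynomial.ringHom_ext (fun c => ?_) (fun p => ?_) <;> simp [translate, algebraMap_eq]
  exact DFunLike.congr_fun this f

/-- Let `W` be a finite-dimensional stable space of polynomials in which every nonzero stable
subspace contains `v`, where `v ≠ 0` has real coefficients. Then `W` is generated by `v`. -/
theorem span_translate_eq {W : Submodule ℂ (MvPolynomial (Fin n × Fin n) ℂ)}
    [FiniteDimensional ℂ W] {v : MvPolynomial (Fin n × Fin n) ℂ} (hv0 : v ≠ 0) (hvW : v ∈ W)
    (hreal : map (starRingEnd ℂ) v = v)
    (hW : ∀ A, ∀ f ∈ W, translate A f ∈ W)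
    (hmin : ∀ N ≤ W, N ≠ ⊥ → (∀ A, ∀ f ∈ N, translate A f ∈ N) → v ∈ N) :
    Submodule.span ℂ (Set.range fun u : Matrix.unitaryGroup (Fin n) ℂ => translate u v) = W := by
  set V := Submodule.span ℂ (Set.range fun u : Matrix.unitaryGroup (Fin n) ℂ => translate u v)
    with hV
  have hVW : V ≤ W := Submodule.span_le.mpr (by rintro _ ⟨u, rfl⟩; exact hW _ _ hvW)
  have hvV : v ∈ V := Submodule.subset_span ⟨1, by simp [translate_one]⟩
  have hVst : ∀ A, ∀ f ∈ V, translate A f ∈ V := by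
    intro A
    refine translate_mem (fun u f hf => ?_) A
    induction hf using Submodule.span_induction with
    | mem x hx =>
      obtain ⟨w, rfl⟩ := hx
      refine Submodule.subset_span ⟨u * w, ?_⟩
      simp [translate_mul]
    | zero => simp
    | add x y _ _ hx hy => rw [map_add]; exact V.add_mem hx hy
    | smul c x _ hx => rw [map_smul]; exact V.smul_mem c hx
  have hVconj : ∀ f ∈ V, map (starRingEnd ℂ) f ∈ V := by
    intro f hf
    induction hf using Submodule.span_induction with
    | mem x hx =>
      obtain ⟨w, rfl⟩ := hx
      dsimp only
      rw [map_star_translate, hreal]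
      exact hVst _ _ hvV
    | zero => simp
    | add x y _ _ hx hy => rw [map_add]; exact V.add_mem hx hy
    | smul c x _ hx =>
      rw [smul_eq_C_mul, map_mul, map_C, C_mul']
      exact V.smul_mem _ hx
  by_contra hne
  have hlt : V < W := lt_of_le_of_ne hVW hne
  have : FiniteDimensional ℂ V := Submodule.finiteDimensional_of_le hVW
  -- The orthogonal complement of `V` in `W`. It is nonzero by dimension and stable by adjointness,
  -- so it contains `v`, which contradicts positivity because `V` is closed under conjugation.
  let N : Submodule ℂ (MvPolynomial (Fin n × Fin n) ℂ) :=
    W ⊓ ⨅ f : V, LinearMap.ker (fischer (f : MvPolynomial (Fin n × Fin n) ℂ))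
  have hN : ∀ g, g ∈ N ↔ g ∈ W ∧ ∀ f ∈ V, fischer f g = 0 := by
    intro g
    simp [N, Submodule.mem_iInf]
  have hNbot : N ≠ ⊥ := by
    let T : W →ₗ[ℂ] Module.Dual ℂ V := fischer.flip.compl₁₂ W.subtype V.subtype
    have hT : LinearMap.ker T ≠ ⊥ := T.ker_ne_bot_of_finrank_lt (by
      rw [Subspace.dual_finrank_eq]
      exact Submodule.finrank_lt_finrank_of_lt hlt)
    obtain ⟨g, hg, hg0⟩ := Submodule.exists_mem_ne_zero_of_ne_bot hT
    refine fun hb => hg0 (Subtype.ext ?_)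
    have : (g : MvPolynomial (Fin n × Fin n) ℂ) ∈ N :=
      (hN _).mpr ⟨g.2, fun f hf => LinearMap.congr_fun (LinearMap.mem_ker.mp hg) ⟨f, hf⟩⟩
    rw [hb] at this
    exact this
  have hvN := hmin N inf_le_left hNbot (fun A f hf => by
    rw [hN] at hf ⊢
    refine ⟨hW A f hf.1, fun g hg => ?_⟩
    rw [← A.transpose_transpose, ← fischer_translate]
    exact hf.2 _ (hVst _ _ hg))
  exact hv0 (fischer_map_star_self v (((hN v).mp hvN).2 _ (hVconj v hvV)))

end Fischer

/-! ### Plücker coordinates on `3 × 3` matrices -/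

/-- The entries of the first row of the generic `3 × 3` matrix. -/
noncomputable def rowVar (l : Fin 3) : MvPolynomial (Fin 3 × Fin 3) ℂ := X (0, l)

/-- The signed `2 × 2` minors of the first two rows of the generic `3 × 3` matrix. -/
noncomputable def minorVar : Fin 3 → MvPolynomial (Fin 3 × Fin 3) ℂ :=
  ![X (0, 1) * X (1, 2) - X (0, 2) * X (1, 1), X (0, 2) * X (1, 0) - X (0, 0) * X (1, 2),
    X (0, 0) * X (1, 1) - X (0, 1) * X (1, 0)]

/-- The determinant of the generic `3 × 3` matrix. -/
noncomputable def genericDet : MvPolynomial (Fin 3 × Fin 3) ℂ :=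
  (Matrix.of fun i j : Fin 3 => (X (i, j) : MvPolynomial (Fin 3 × Fin 3) ℂ)).det

/-- The signed minors are the cross product of the first two rows, hence orthogonal to the first
row. -/
lemma plucker : rowVar 0 * minorVar 0 + rowVar 1 * minorVar 1 + rowVar 2 * minorVar 2 = 0 := by
  simp only [rowVar, minorVar, Matrix.cons_val]
  ring

lemma translate_rowVar (A : Matrix (Fin 3) (Fin 3) ℂ) (l : Fin 3) :
    translate A (rowVar l) = ∑ j, C (A j l) * rowVar j := by
  simp [translate, rowVar, mul_comm]

lemma translate_minorVar (A : Matrix (Fin 3) (Fin 3) ℂ) (l : Fin 3) :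
    translate A (minorVar l) = ∑ j, C (A.adjugate l j) * minorVar j := by
  rw [Matrix.adjugate_fin_three]
  fin_cases l <;>
  · simp [translate, minorVar, Fin.sum_univ_three]
    ring

lemma translate_genericDet (A : Matrix (Fin 3) (Fin 3) ℂ) :
    translate A genericDet = C A.det * genericDet := by
  rw [genericDet, AlgHom.map_det, RingHom.map_det, mul_comm, ← Matrix.det_mul]
  congr 1
  ext1 i j
  simp [translate, Matrix.mul_apply]

/-- The monomials in the Plücker coordinates. -/
noncomputable def pluckerMon (k a₀ a₁ a₂ b₀ b₁ b₂ : ℕ) : MvPolynomial (Fin 3 × Fin 3) ℂ :=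
  genericDet ^ k * (rowVar 0 ^ a₀ * rowVar 1 ^ a₁ * rowVar 2 ^ a₂ *
    (minorVar 0 ^ b₀ * minorVar 1 ^ b₁ * minorVar 2 ^ b₂))

lemma highestWeightVector_eq {a b : ℕ} (h : b ≤ a) (k : ℕ) :
    highestWeightVector 3 ![a + k, b + k, k] = pluckerMon k (a - b) 0 0 0 0 b := by
  have h1 : leadingMinor 3 1 (by norm_num) = rowVar 0 := by
    simp [leadingMinor, rowVar]
  have h2 : leadingMinor 3 2 (by norm_num) = minorVar 2 := by
    simp [leadingMinor, minorVar, Matrix.det_fin_two]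
  have h3 : leadingMinor 3 3 (by norm_num) = genericDet := by
    simp [leadingMinor, genericDet]
  rw [highestWeightVector, Fin.prod_univ_three]
  have e1 : a + k - (b + k) = a - b := by omega
  have e2 : b + k - k = b := by omega
  simp [h1, h2, h3, pluckerMon, e1, e2]
  ring

/-- The space of polynomials of degrees `z`, `b`, `k` in the three kinds of Plücker coordinates. -/
noncomputable def pluckerSpace (z b k : ℕ) : Submodule ℂ (MvPolynomial (Fin 3 × Fin 3) ℂ) :=
  Submodule.span ℂ {genericDet ^ k} *
    (Submodule.span ℂ (Set.range rowVar) ^ z * Submodule.span ℂ (Set.range minorVar) ^ b)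

lemma pluckerMon_mem (k a₀ a₁ a₂ b₀ b₁ b₂ : ℕ) :
    pluckerMon k a₀ a₁ a₂ b₀ b₁ b₂ ∈ pluckerSpace (a₀ + a₁ + a₂) (b₀ + b₁ + b₂) k := by
  refine Submodule.mul_mem_mul (Submodule.mem_span_singleton_self _) (Submodule.mul_mem_mul ?_ ?_)
  all_goals
    rw [pow_add, pow_add]
    exact Submodule.mul_mem_mul (Submodule.mul_mem_mul
      (Submodule.pow_mem_pow _ (Submodule.subset_span (Set.mem_range_self _)) _)
      (Submodule.pow_mem_pow _ (Submodule.subset_span (Set.mem_range_self _)) _))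
      (Submodule.pow_mem_pow _ (Submodule.subset_span (Set.mem_range_self _)) _)

lemma translate_mem_pluckerSpace {z b k : ℕ} (A : Matrix (Fin 3) (Fin 3) ℂ) :
    ∀ f ∈ pluckerSpace z b k, translate A f ∈ pluckerSpace z b k := by
  have hx : (Submodule.span ℂ (Set.range rowVar)).map (translate A).toLinearMap ≤
      Submodule.span ℂ (Set.range rowVar) := by
    rw [Submodule.map_span_le]
    rintro _ ⟨l, rfl⟩
    rw [AlgHom.toLinearMap_apply, translate_rowVar]
    refine Submodule.sum_mem _ fun j _ => ?_
    rw [C_mul']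
    exact Submodule.smul_mem _ _ (Submodule.subset_span ⟨j, rfl⟩)
  have hp : (Submodule.span ℂ (Set.range minorVar)).map (translate A).toLinearMap ≤
      Submodule.span ℂ (Set.range minorVar) := by
    rw [Submodule.map_span_le]
    rintro _ ⟨l, rfl⟩
    rw [AlgHom.toLinearMap_apply, translate_minorVar]
    refine Submodule.sum_mem _ fun j _ => ?_
    rw [C_mul']
    exact Submodule.smul_mem _ _ (Submodule.subset_span ⟨j, rfl⟩)
  have hd : (Submodule.span ℂ {genericDet ^ k}).map (translate A).toLinearMap ≤
      Submodule.span ℂ {genericDet ^ k} := by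
    rw [Submodule.map_span_le]
    rintro _ rfl
    rw [AlgHom.toLinearMap_apply, map_pow, translate_genericDet, mul_pow, ← C_pow, C_mul']
    exact Submodule.smul_mem _ _ (Submodule.mem_span_singleton_self _)
  have h : (pluckerSpace z b k).map (translate A).toLinearMap ≤ pluckerSpace z b k := by
    rw [pluckerSpace, Submodule.map_mul, Submodule.map_mul, Submodule.map_pow, Submodule.map_pow]
    exact mul_le_mul' hd (mul_le_mul' (pow_le_pow_left' hx z) (pow_le_pow_left' hp b))
  exact fun f hf => h (Submodule.mem_map_of_mem hf)

/-- The exponents `(a₀, a₁, b₀, b₁)` of the standard monomials, those in which the last coordinates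
of the two kinds do not both occur. -/
def std (z b : ℕ) : Finset (ℕ × ℕ × ℕ × ℕ) :=
  (Finset.range (z + 1) ×ˢ Finset.range (z + 1) ×ˢ Finset.range (b + 1) ×ˢ
    Finset.range (b + 1)).filter fun q => q.1 + q.2.1 ≤ z ∧ q.2.2.1 + q.2.2.2 ≤ b ∧
      (q.1 + q.2.1 = z ∨ q.2.2.1 + q.2.2.2 = b)

lemma mem_std {z b : ℕ} {q : ℕ × ℕ × ℕ × ℕ} : q ∈ std z b ↔ q.1 + q.2.1 ≤ z ∧
    q.2.2.1 + q.2.2.2 ≤ b ∧ (q.1 + q.2.1 = z ∨ q.2.2.1 + q.2.2.2 = b) := by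
  simp only [std, Finset.mem_filter, Finset.mem_product, Finset.mem_range]
  omega

/-- The standard monomial with given exponents. -/
noncomputable def stdMon (z b k : ℕ) (q : ℕ × ℕ × ℕ × ℕ) : MvPolynomial (Fin 3 × Fin 3) ℂ :=
  pluckerMon k q.1 q.2.1 (z - q.1 - q.2.1) q.2.2.1 q.2.2.2 (b - q.2.2.1 - q.2.2.2)

/-- Straightening: the Plücker relation replaces a factor `x₂p₂` by `-x₀p₀ - x₁p₁`, which lowers
`b₂` and keeps both degrees. -/
lemma pluckerMon_mem_span_stdMon (k a₀ a₁ a₂ b₀ b₁ b₂ : ℕ) :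
    pluckerMon k a₀ a₁ a₂ b₀ b₁ b₂ ∈ Submodule.span ℂ
      (stdMon (a₀ + a₁ + a₂) (b₀ + b₁ + b₂) k '' std (a₀ + a₁ + a₂) (b₀ + b₁ + b₂)) := by
  induction b₂ generalizing a₀ a₁ a₂ b₀ b₁ with
  | zero =>
    refine Submodule.subset_span ⟨(a₀, a₁, b₀, b₁), Finset.mem_coe.mpr (mem_std.mpr ?_), ?_⟩
    · dsimp only; omega
    · simp only [stdMon]
      congr 1 <;> omega
  | succ n ih =>
    cases a₂ with
    | zero =>
      refine Submodule.subset_span ⟨(a₀, a₁, b₀, b₁), Finset.mem_coe.mpr (mem_std.mpr ?_), ?_⟩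
      · dsimp only; omega
      · simp only [stdMon]
        congr 1 <;> omega
    | succ c =>
      have h : pluckerMon k a₀ a₁ (c + 1) b₀ b₁ (n + 1) =
          -pluckerMon k (a₀ + 1) a₁ c (b₀ + 1) b₁ n - pluckerMon k a₀ (a₁ + 1) c b₀ (b₁ + 1) n := by
        simp only [pluckerMon]
        linear_combination genericDet ^ k * (rowVar 0 ^ a₀ * rowVar 1 ^ a₁ * rowVar 2 ^ c *
          (minorVar 0 ^ b₀ * minorVar 1 ^ b₁ * minorVar 2 ^ n)) * plucker
      have h1 := ih (a₀ + 1) a₁ c (b₀ + 1) b₁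
      have h2 := ih a₀ (a₁ + 1) c b₀ (b₁ + 1)
      rw [show a₀ + 1 + a₁ + c = a₀ + a₁ + (c + 1) by ring,
        show b₀ + 1 + b₁ + n = b₀ + b₁ + (n + 1) by ring] at h1
      rw [show a₀ + (a₁ + 1) + c = a₀ + a₁ + (c + 1) by ring,
        show b₀ + (b₁ + 1) + n = b₀ + b₁ + (n + 1) by ring] at h2
      rw [h]
      exact Submodule.sub_mem _ (Submodule.neg_mem _ h1) h2

lemma span_range_pow_le {A : Type*} [CommRing A] [Algebra ℂ A] (x : Fin 3 → A) (n : ℕ) :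
    Submodule.span ℂ (Set.range x) ^ n ≤ Submodule.span ℂ
      {f | ∃ a₀ a₁ a₂, a₀ + a₁ + a₂ = n ∧ f = x 0 ^ a₀ * x 1 ^ a₁ * x 2 ^ a₂} := by
  induction n with
  | zero =>
    rw [pow_zero, Submodule.one_eq_span]
    refine Submodule.span_mono ?_
    rintro _ rfl
    exact ⟨0, 0, 0, rfl, by simp⟩
  | succ n ih =>
    rw [pow_succ]
    refine (mul_le_mul_left ih _).trans ?_
    rw [Submodule.span_mul_span]
    refine Submodule.span_mono ?_
    rintro _ ⟨_, ⟨a₀, a₁, a₂, rfl, rfl⟩, _, ⟨l, rfl⟩, rfl⟩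
    fin_cases l
    · exact ⟨a₀ + 1, a₁, a₂, by ring, by simp; ring⟩
    · exact ⟨a₀, a₁ + 1, a₂, by ring, by simp; ring⟩
    · exact ⟨a₀, a₁, a₂ + 1, by ring, by simp; ring⟩

lemma pluckerSpace_eq_span (z b k : ℕ) :
    pluckerSpace z b k = Submodule.span ℂ (stdMon z b k '' std z b) := by
  refine le_antisymm ?_ (Submodule.span_le.mpr ?_)
  · refine (mul_le_mul_right (mul_le_mul' (span_range_pow_le rowVar z)
      (span_range_pow_le minorVar b)) _).trans ?_
    rw [Submodule.span_mul_span, Submodule.span_mul_span, Submodule.span_le]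
    rintro _ ⟨_, rfl, _, ⟨_, ⟨a₀, a₁, a₂, rfl, rfl⟩, _, ⟨b₀, b₁, b₂, rfl, rfl⟩, rfl⟩, rfl⟩
    exact pluckerMon_mem_span_stdMon k a₀ a₁ a₂ b₀ b₁ b₂
  · rintro _ ⟨q, hq, rfl⟩
    have h := mem_std.mp (Finset.mem_coe.mp hq)
    have := pluckerMon_mem k q.1 q.2.1 (z - q.1 - q.2.1) q.2.2.1 q.2.2.2 (b - q.2.2.1 - q.2.2.2)
    rwa [show q.1 + q.2.1 + (z - q.1 - q.2.1) = z by omega,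
      show q.2.2.1 + q.2.2.2 + (b - q.2.2.1 - q.2.2.2) = b by omega] at this

instance finiteDimensional_pluckerSpace (z b k : ℕ) : FiniteDimensional ℂ (pluckerSpace z b k) := by
  rw [pluckerSpace_eq_span]
  exact FiniteDimensional.span_of_finite ℂ ((std z b).finite_toSet.image _)

/-! ### Torus weights and generation by the highest weight vector -/

lemma translate_diagonal_pluckerMon (d : Fin 3 → ℂ) (k a₀ a₁ a₂ b₀ b₁ b₂ : ℕ) :
    translate (Matrix.diagonal d) (pluckerMon k a₀ a₁ a₂ b₀ b₁ b₂) =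
      C ((d 0 * d 1 * d 2) ^ k * (d 0 ^ a₀ * d 1 ^ a₁ * d 2 ^ a₂ *
        ((d 1 * d 2) ^ b₀ * (d 0 * d 2) ^ b₁ * (d 0 * d 1) ^ b₂))) *
        pluckerMon k a₀ a₁ a₂ b₀ b₁ b₂ := by
  have hx : ∀ l, translate (Matrix.diagonal d) (rowVar l) = C (d l) * rowVar l := by
    intro l
    rw [translate_rowVar]
    simp [Matrix.diagonal_apply, apply_ite C, ite_mul]
  have hp : ∀ l, translate (Matrix.diagonal d) (minorVar l) =
      C (![d 1 * d 2, d 0 * d 2, d 0 * d 1] l) * minorVar l := by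
    intro l
    rw [translate_minorVar, Matrix.adjugate_fin_three, Fin.sum_univ_three]
    fin_cases l <;> simp
  simp only [pluckerMon, map_mul, map_pow, hx, hp, translate_genericDet, Matrix.det_diagonal,
    Fin.prod_univ_three, Matrix.cons_val]
  ring

/-- The coefficient of the highest weight vector in `g` is the value of `g` at the identity
matrix. -/
lemma exists_polynomial_diagonal {z b k : ℕ} {g : MvPolynomial (Fin 3 × Fin 3) ℂ}
    (hg : g ∈ pluckerSpace z b k) :
    ∃ q : Polynomial (MvPolynomial (Fin 3 × Fin 3) ℂ),
      (∀ t : ℂ, translate (Matrix.diagonal ![1, t, t ^ 2]) g = q.eval (C t)) ∧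
      q.coeff (b + 3 * k) =
        eval (fun p => (1 : Matrix (Fin 3) (Fin 3) ℂ) p.1 p.2) g • pluckerMon k z 0 0 0 0 b := by
  rw [pluckerSpace_eq_span] at hg
  induction hg using Submodule.span_induction with
  | mem g hg =>
    obtain ⟨q, hq, rfl⟩ := hg
    have h := mem_std.mp (Finset.mem_coe.mp hq)
    obtain ⟨a₀, a₁, b₀, b₁⟩ := q
    dsimp only at h
    obtain ⟨a₂, rfl⟩ := Nat.exists_eq_add_of_le h.1
    obtain ⟨b₂, rfl⟩ := Nat.exists_eq_add_of_le h.2.1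
    have e1 : a₀ + a₁ + a₂ - a₀ - a₁ = a₂ := by omega
    have e2 : b₀ + b₁ + b₂ - b₀ - b₁ = b₂ := by omega
    simp only [stdMon, e1, e2]
    -- Under `diag(1, t, t²)` the `x` have weights `0, 1, 2`, the `p` have weights `3, 2, 1` and the
    -- determinant has weight `3`. The minimum `b + 3 * k` is attained only by the highest weight
    -- vector.
    refine ⟨Polynomial.monomial (3 * k + a₁ + 2 * a₂ + 3 * b₀ + 2 * b₁ + b₂)
      (pluckerMon k a₀ a₁ a₂ b₀ b₁ b₂), fun t => ?_, ?_⟩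
    · rw [translate_diagonal_pluckerMon, Polynomial.eval_monomial, mul_comm, ← C_pow]
      congr 2
      simp
      ring
    · have he : eval (fun p => (1 : Matrix (Fin 3) (Fin 3) ℂ) p.1 p.2)
          (pluckerMon k a₀ a₁ a₂ b₀ b₁ b₂) = 0 ^ a₁ * 0 ^ a₂ * 0 ^ b₀ * 0 ^ b₁ := by
        have hd : eval (fun p => (1 : Matrix (Fin 3) (Fin 3) ℂ) p.1 p.2) genericDet = 1 := by
          rw [genericDet, Matrix.det_fin_three]
          simp
        simp only [pluckerMon, map_mul, map_pow, hd, one_pow, one_mul]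
        simp [rowVar, minorVar, mul_assoc]
      rw [he, Polynomial.coeff_monomial]
      by_cases h0 : a₁ = 0 ∧ a₂ = 0 ∧ b₀ = 0 ∧ b₁ = 0
      · obtain ⟨rfl, rfl, rfl, rfl⟩ := h0
        rw [if_pos (by ring)]
        simp
      · rw [if_neg (by omega)]
        symm
        convert zero_smul ℂ _
        simp only [mul_eq_zero, pow_eq_zero_iff', ne_eq, true_and]
        tauto
  | zero => exact ⟨0, by simp, by simp⟩
  | add f g _ _ hf hg =>
    obtain ⟨q, h1, h2⟩ := hf
    obtain ⟨r, h3, h4⟩ := hg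
    exact ⟨q + r, fun t => by rw [map_add, h1, h3, Polynomial.eval_add],
      by rw [Polynomial.coeff_add, h2, h4, map_add, add_smul]⟩
  | smul c f _ hf =>
    obtain ⟨q, h1, h2⟩ := hf
    exact ⟨c • q, fun t => by rw [map_smul, h1, Polynomial.eval_smul],
      by rw [Polynomial.coeff_smul, h2, smul_eval, mul_smul]⟩

lemma genericDet_ne_zero : genericDet ≠ 0 := by
  intro h
  have := congrArg (eval (fun p => (1 : Matrix (Fin 3) (Fin 3) ℂ) p.1 p.2)) h
  rw [genericDet, Matrix.det_fin_three] at this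
  simp at this

lemma pluckerMon_highest_ne_zero (k z b : ℕ) : pluckerMon k z 0 0 0 0 b ≠ 0 := by
  intro h
  have := congrArg (eval (fun p => (1 : Matrix (Fin 3) (Fin 3) ℂ) p.1 p.2)) h
  simp only [pluckerMon, genericDet, Matrix.det_fin_three] at this
  simp [rowVar, minorVar] at this

lemma map_star_pluckerMon (k a₀ a₁ a₂ b₀ b₁ b₂ : ℕ) :
    map (starRingEnd ℂ) (pluckerMon k a₀ a₁ a₂ b₀ b₁ b₂) = pluckerMon k a₀ a₁ a₂ b₀ b₁ b₂ := by
  simp [pluckerMon, genericDet, Matrix.det_fin_three, rowVar, minorVar]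

/-- The representation with highest weight `(a + k, b + k, k)` is the space of polynomials of
degrees `a - b`, `b`, `k` in the Plücker coordinates. -/
theorem irrep_toSubmodule_eq {a b : ℕ} (h : b ≤ a) (k : ℕ) :
    (irrep 3 ![a + k, b + k, k]).toSubmodule = pluckerSpace (a - b) b k := by
  have hv : pluckerMon k (a - b) 0 0 0 0 b ∈ pluckerSpace (a - b) b k := by
    simpa using pluckerMon_mem k (a - b) 0 0 0 0 b
  rw [← span_translate_eq (pluckerMon_highest_ne_zero k (a - b) b) hv (map_star_pluckerMon ..)
    translate_mem_pluckerSpace, ← highestWeightVector_eq h k]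
  · rfl
  · intro N hNW hN hst
    obtain ⟨f, hf, hf0⟩ := Submodule.exists_mem_ne_zero_of_ne_bot hN
    obtain ⟨x, hx⟩ : ∃ x, eval x f ≠ 0 := by
      by_contra hx
      push Not at hx
      exact hf0 (MvPolynomial.funext fun x => by rw [hx x, map_zero])
    -- Translation by a matrix where `f` does not vanish moves that nonzero value to the identity,
    -- where it becomes the coefficient of the highest weight vector.
    set A : Matrix (Fin 3) (Fin 3) ℂ := Matrix.of fun i j => x (i, j) with hA
    have hev : eval (fun p => (1 : Matrix (Fin 3) (Fin 3) ℂ) p.1 p.2) (translate A f) =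
        eval x f := by
      have : (eval (fun p : Fin 3 × Fin 3 => (1 : Matrix (Fin 3) (Fin 3) ℂ) p.1 p.2)).comp
          (translate A : MvPolynomial (Fin 3 × Fin 3) ℂ →+* MvPolynomial (Fin 3 × Fin 3) ℂ) =
          eval x := by
        refine MvPolynomial.ringHom_ext (fun c => ?_) (fun p => ?_)
        · simp [translate, algebraMap_eq]
        · simp [translate, Matrix.one_apply, hA]
      exact DFunLike.congr_fun this f
    obtain ⟨q, h1, h2⟩ := exists_polynomial_diagonal (translate_mem_pluckerSpace A f (hNW hf))
    have h3 := coeff_mem_of_eval_mem N q Set.infinite_univ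
      (fun t _ => by rw [← h1]; exact hst _ _ (hst _ _ hf)) (b + 3 * k)
    rw [h2, hev] at h3
    exact (N.smul_mem_iff hx).mp h3

/-! ### Linear independence of the standard monomials -/

/-- In a nontrivial relation the largest leading exponent occurs in only one term and cannot cancel.
-/
lemma linearIndependent_of_degree_injective {ι σ R : Type*} [CommRing R] [IsDomain R]
    (o : MonomialOrder σ) {f : ι → MvPolynomial σ R} (h0 : ∀ i, f i ≠ 0)
    (hinj : Function.Injective fun i => o.degree (f i)) : LinearIndependent R f := by
  classical
  rw [linearIndependent_iff']
  intro s g hg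
  by_contra! hne
  obtain ⟨i₀, hi₀, hgi₀⟩ := hne
  obtain ⟨i, hi, hmax⟩ := Finset.exists_max_image (s.filter fun i => g i ≠ 0)
    (fun i => o.toSyn (o.degree (f i))) ⟨i₀, Finset.mem_filter.mpr ⟨hi₀, hgi₀⟩⟩
  rw [Finset.mem_filter] at hi
  have h1 := congrArg (coeff (o.degree (f i))) hg
  rw [coeff_sum, Finset.sum_eq_single_of_mem i hi.1, coeff_smul, coeff_zero, smul_eq_mul,
    mul_eq_zero, o.coeff_degree_eq_zero_iff] at h1
  · exact h1.elim hi.2 (h0 i)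
  · intro j hj hji
    rw [coeff_smul, smul_eq_mul, mul_eq_zero]
    by_cases hgj : g j = 0
    · exact Or.inl hgj
    · refine Or.inr (o.coeff_eq_zero_of_lt (lt_of_le_of_ne
        (hmax j (Finset.mem_filter.mpr ⟨hj, hgj⟩)) fun he => hji (hinj ?_)))
      exact o.toSyn.injective he

/-- The specialization of the generic matrix at which the last entry of the second row and all
entries of the third row vanish. -/
noncomputable def specializeMatrix :
    MvPolynomial (Fin 3 × Fin 3) ℂ →ₐ[ℂ] MvPolynomial (Fin 5) ℂ :=
  aeval fun p => (![![X 0, X 1, X 2], ![X 4, X 3, 0], 0] : Fin 3 → Fin 3 → _) p.1 p.2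

/-- Two minors become monomials up to sign, and only the third needs a leading term. The determinant
specialises to zero, hence the restriction to exponent `0` of it. -/
lemma specialize_pluckerMon (a₀ a₁ a₂ b₀ b₁ b₂ : ℕ) :
    specializeMatrix (pluckerMon 0 a₀ a₁ a₂ b₀ b₁ b₂) =
      X 0 ^ a₀ * X 1 ^ a₁ * X 2 ^ a₂ *
        ((-(X 2 * X 3)) ^ b₀ * (X 2 * X 4) ^ b₁ * (X 0 * X 3 - X 1 * X 4) ^ b₂) := by
  simp [pluckerMon, specializeMatrix, rowVar, minorVar]

lemma degree_X_mul_X (i j : Fin 5) :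
    MonomialOrder.lex.degree (X i * X j : MvPolynomial (Fin 5) ℂ) =
      Finsupp.single i 1 + Finsupp.single j 1 := by
  rw [MonomialOrder.degree_mul (X_ne_zero i) (X_ne_zero j), MonomialOrder.degree_X,
    MonomialOrder.degree_X]

lemma degree_plucker_binomial :
    MonomialOrder.lex.degree (X 0 * X 3 - X 1 * X 4 : MvPolynomial (Fin 5) ℂ) =
      Finsupp.single 0 1 + Finsupp.single 3 1 := by
  rw [MonomialOrder.degree_sub_of_lt, degree_X_mul_X]
  rw [degree_X_mul_X, degree_X_mul_X, MonomialOrder.lex_lt_iff]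
  exact ⟨0, fun j hj => absurd hj (by simp), by simp⟩

lemma plucker_binomial_ne_zero : (X 0 * X 3 - X 1 * X 4 : MvPolynomial (Fin 5) ℂ) ≠ 0 := by
  intro h
  have h1 := degree_plucker_binomial
  rw [h, MonomialOrder.degree_zero] at h1
  simpa using DFunLike.congr_fun h1 0

lemma specialize_ne_zero (a₀ a₁ a₂ b₀ b₁ b₂ : ℕ) :
    specializeMatrix (pluckerMon 0 a₀ a₁ a₂ b₀ b₁ b₂) ≠ 0 := by
  rw [specialize_pluckerMon]
  have := plucker_binomial_ne_zero
  simp [X_ne_zero, this]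

lemma degree_specialize (a₀ a₁ a₂ b₀ b₁ b₂ : ℕ) :
    MonomialOrder.lex.degree (specializeMatrix (pluckerMon 0 a₀ a₁ a₂ b₀ b₁ b₂)) =
      a₀ • Finsupp.single 0 1 + a₁ • Finsupp.single 1 1 + a₂ • Finsupp.single 2 1 +
      (b₀ • (Finsupp.single 2 1 + Finsupp.single 3 1) +
       b₁ • (Finsupp.single 2 1 + Finsupp.single 4 1) +
       b₂ • (Finsupp.single 0 1 + Finsupp.single 3 1)) := by
  have h := specialize_ne_zero a₀ a₁ a₂ b₀ b₁ b₂
  rw [specialize_pluckerMon] at h ⊢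
  have h1 := left_ne_zero_of_mul h
  have h2 := right_ne_zero_of_mul h
  rw [MonomialOrder.degree_mul' h, MonomialOrder.degree_mul' h1,
    MonomialOrder.degree_mul' (left_ne_zero_of_mul h1), MonomialOrder.degree_mul' h2,
    MonomialOrder.degree_mul' (left_ne_zero_of_mul h2)]
  simp only [MonomialOrder.degree_pow, MonomialOrder.degree_neg, degree_X_mul_X,
    degree_plucker_binomial, MonomialOrder.degree_X]

theorem linearIndependent_stdMon (z b k : ℕ) :
    LinearIndependent ℂ fun q : std z b => stdMon z b k q := by
  have h1 : LinearIndependent ℂ fun q : std z b => stdMon z b 0 q := by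
    refine LinearIndependent.of_comp specializeMatrix.toLinearMap
      (linearIndependent_of_degree_injective MonomialOrder.lex
        (fun q => specialize_ne_zero _ _ _ _ _ _) ?_)
    rintro ⟨⟨a₀, a₁, b₀, b₁⟩, hq⟩ ⟨⟨c₀, c₁, d₀, d₁⟩, hr⟩ h
    simp only [Function.comp_apply, AlgHom.toLinearMap_apply, stdMon, degree_specialize] at h
    -- With `z` and `b` given, the leading exponent determines `a₁`, `b₁` and `a₀ - b₀`.
    -- Standardness then fixes `a₀`, since one of the two degrees must be exhausted.
    have e0 := DFunLike.congr_fun h 0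
    have e1 := DFunLike.congr_fun h 1
    have e2 := DFunLike.congr_fun h 2
    have e3 := DFunLike.congr_fun h 3
    have e4 := DFunLike.congr_fun h 4
    simp at e0 e1 e2 e3 e4
    rw [mem_std] at hq hr
    simp only [Subtype.mk.injEq, Prod.mk.injEq]
    dsimp only at hq hr
    omega
  have h2 := h1.map' (LinearMap.mulLeft ℂ (genericDet ^ k)) (LinearMap.ker_eq_bot.mpr
    (mul_right_injective₀ (pow_ne_zero k genericDet_ne_zero)))
  have h3 : (fun q : std z b => stdMon z b k q) =
      LinearMap.mulLeft ℂ (genericDet ^ k) ∘ fun q : std z b => stdMon z b 0 q := by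
    funext q
    simp [stdMon, pluckerMon]
  rw [h3]
  exact h2

/-! ### Invariants -/

lemma trivialMultiplicity_eq_finrank {a b : ℕ} (h : b ≤ a) (k : ℕ)
    (H : Subgroup (Matrix.unitaryGroup (Fin 3) ℂ))
    (N : Submodule ℂ (MvPolynomial (Fin 3 × Fin 3) ℂ))
    (hN : ∀ f, f ∈ N ↔ f ∈ pluckerSpace (a - b) b k ∧ ∀ u ∈ H, translation 3 u f = f) :
    trivialMultiplicity ![a + k, b + k, k] H = Module.finrank ℂ N := by
  rw [trivialMultiplicity, ← Submodule.finrank_map_subtype_eq]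
  suffices h : Submodule.map (irrep 3 ![a + k, b + k, k]).toSubmodule.subtype
      (Representation.invariants
        ((irrep 3 ![a + k, b + k, k]).toRepresentation.comp H.subtype)) = N by rw [h]
  ext f
  rw [hN, ← irrep_toSubmodule_eq h k, Submodule.mem_map]
  constructor
  · rintro ⟨g, hg, rfl⟩
    exact ⟨g.2, fun u hu => congrArg Subtype.val (hg ⟨u, hu⟩)⟩
  · rintro ⟨hf, hu⟩
    exact ⟨⟨f, hf⟩, fun u => Subtype.ext (hu u u.2), rfl⟩

/-- The standard monomials of weight zero under `U(1)`. -/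
def stdZero (z b : ℕ) : Finset (ℕ × ℕ × ℕ × ℕ) :=
  (std z b).filter fun q => q.1 + q.2.2.2 = q.2.1 + q.2.2.1

lemma translation_circle_stdMon (t : Circle) (z b k : ℕ) (q : ℕ × ℕ × ℕ × ℕ) :
    translation 3 (circleEmbedding t) (stdMon z b k q) =
      ((t : ℂ) ^ (q.1 + q.2.2.2) * ((t : ℂ)⁻¹) ^ (q.2.1 + q.2.2.1)) • stdMon z b k q := by
  have ht : (t : ℂ) ≠ 0 := Circle.coe_ne_zero t
  have h : translation 3 (circleEmbedding t) (stdMon z b k q) =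
      translate (Matrix.diagonal ![(t : ℂ), ((t⁻¹ : Circle) : ℂ), 1]) (stdMon z b k q) := rfl
  rw [h, stdMon, translate_diagonal_pluckerMon, C_mul']
  congr 1
  simp only [Matrix.cons_val, Circle.coe_inv, mul_inv_cancel₀ ht, one_pow, mul_one, one_mul]
  ring

lemma exists_circle_pow_ne {m n : ℕ} (h : m ≠ n) :
    ∃ t : Circle, (t : ℂ) ^ m * ((t : ℂ)⁻¹) ^ n ≠ 1 := by
  -- Chosen so that the `(m - n)`-th power is `-1`.
  refine ⟨Circle.exp (Real.pi / ((m : ℝ) - n)), ?_⟩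
  have h0 : (m : ℝ) - n ≠ 0 := sub_ne_zero.mpr (by exact_mod_cast h)
  have h0' : (m : ℂ) - n ≠ 0 := sub_ne_zero.mpr (by exact_mod_cast h)
  rw [Circle.coe_exp, ← Complex.exp_neg, ← Complex.exp_nat_mul, ← Complex.exp_nat_mul,
    ← Complex.exp_add]
  have : (m : ℂ) * (((Real.pi / ((m : ℝ) - n) : ℝ) : ℂ) * Complex.I) +
      (n : ℂ) * -(((Real.pi / ((m : ℝ) - n) : ℝ) : ℂ) * Complex.I) = Real.pi * Complex.I := by
    push_cast
    field_simp
    ring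
  rw [this, Complex.exp_pi_mul_I]
  norm_num

/-- `U(1)` acts diagonally on the standard basis, so an invariant vector has zero coefficient at
every monomial of nonzero weight. -/
lemma mem_span_stdZero_iff {z b k : ℕ} {f : MvPolynomial (Fin 3 × Fin 3) ℂ} :
    f ∈ Submodule.span ℂ (Set.range fun q : stdZero z b => stdMon z b k q) ↔
      f ∈ pluckerSpace z b k ∧ ∀ u ∈ U1, translation 3 u f = f := by
  have hsub : ∀ q ∈ stdZero z b, q ∈ std z b := fun q hq => (Finset.mem_filter.mp hq).1
  constructor
  · intro hf
    refine ⟨?_, ?_⟩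
    · rw [pluckerSpace_eq_span]
      refine Submodule.span_mono ?_ hf
      rintro _ ⟨q, rfl⟩
      exact ⟨q, Finset.mem_coe.mpr (hsub q q.2), rfl⟩
    · rintro _ ⟨t, rfl⟩
      induction hf using Submodule.span_induction with
      | mem x hx =>
        obtain ⟨q, rfl⟩ := hx
        have hq := (Finset.mem_filter.mp q.2).2
        dsimp only
        rw [translation_circle_stdMon, hq, ← mul_pow, mul_inv_cancel₀ (Circle.coe_ne_zero t),
          one_pow, one_smul]
      | zero => rw [map_zero]
      | add x y _ _ hx hy => rw [map_add, hx, hy]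
      | smul c x _ hx => rw [map_smul, hx]
  · rintro ⟨hf, hu⟩
    have hr : stdMon z b k '' std z b = Set.range fun q : std z b => stdMon z b k q := by
      ext g
      simp
    rw [pluckerSpace_eq_span, hr, Submodule.mem_span_range_iff_exists_fun] at hf
    obtain ⟨c, rfl⟩ := hf
    refine Submodule.sum_mem _ fun q _ => ?_
    by_cases hq : q.1.1 + q.1.2.2.2 = q.1.2.1 + q.1.2.2.1
    · exact Submodule.smul_mem _ _
        (Submodule.subset_span ⟨⟨q, Finset.mem_filter.mpr ⟨q.2, hq⟩⟩, rfl⟩)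
    · obtain ⟨t, ht⟩ := exists_circle_pow_ne hq
      have h1 := hu _ ⟨t, rfl⟩
      simp only [map_sum, map_smul, translation_circle_stdMon, smul_smul] at h1
      rw [← sub_eq_zero, ← Finset.sum_sub_distrib] at h1
      simp only [← sub_smul] at h1
      have h2 := Fintype.linearIndependent_iff.mp (linearIndependent_stdMon z b k) _ h1 q
      rw [← mul_sub_one, mul_eq_zero, sub_eq_zero] at h2
      rw [h2.resolve_right ht, zero_smul]
      exact Submodule.zero_mem _

lemma linearIndependent_stdZero (z b k : ℕ) :
    LinearIndependent ℂ fun q : stdZero z b => stdMon z b k q :=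
  (linearIndependent_stdMon z b k).comp
    (fun q : stdZero z b => ⟨q, (Finset.mem_filter.mp q.2).1⟩)
    fun _ _ h => Subtype.ext (congrArg (fun q : std z b => (q : ℕ × ℕ × ℕ × ℕ)) h)

lemma trivialMultiplicity_U1 {a b : ℕ} (h : b ≤ a) (k : ℕ) :
    trivialMultiplicity ![a + k, b + k, k] U1 = (stdZero (a - b) b).card := by
  rw [trivialMultiplicity_eq_finrank h k U1 _ fun f => mem_span_stdZero_iff,
    finrank_span_eq_card (linearIndependent_stdZero (a - b) b k), Fintype.card_coe]

/-- The dimension of the fixed space of a signed permutation of order two. -/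
lemma two_mul_finrank_fixed {ι M : Type*} [Fintype ι] [DecidableEq ι] [AddCommGroup M] [Module ℂ M]
    {e : ι → M} (he : LinearIndependent ℂ e) {σ : ι → ι} (hσ : Function.Involutive σ) {s : ι → ℂ}
    (hs : ∀ i, s i * s (σ i) = 1) {T : M →ₗ[ℂ] M} (hT : ∀ i, T (e i) = s i • e (σ i))
    (N : Submodule ℂ M) (hN : ∀ f, f ∈ N ↔ f ∈ Submodule.span ℂ (Set.range e) ∧ T f = f) :
    (2 : ℂ) * Module.finrank ℂ N = Fintype.card ι + ∑ i, if σ i = i then s i else 0 := by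
  set S := Submodule.span ℂ (Set.range e) with hS
  have hTS : ∀ f ∈ S, T f ∈ S := by
    intro f hf
    induction hf using Submodule.span_induction with
    | mem x hx =>
      obtain ⟨i, rfl⟩ := hx
      rw [hT]
      exact S.smul_mem _ (Submodule.subset_span ⟨_, rfl⟩)
    | zero => rw [map_zero]; exact S.zero_mem
    | add x y _ _ hx hy => rw [map_add]; exact S.add_mem hx hy
    | smul c x _ hx => rw [map_smul]; exact S.smul_mem c hx
  let B : Module.Basis ι ℂ S := Module.Basis.span he
  have hB : ∀ i, (B i : M) = e i := fun i => congrArg Subtype.val (Module.Basis.span_apply he i)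
  have : Module.Finite ℂ S := Module.Finite.of_basis B
  let T' : S →ₗ[ℂ] S := T.restrict hTS
  have hT' : ∀ i, T' (B i) = s i • B (σ i) := by
    intro i
    refine Subtype.ext ?_
    rw [LinearMap.coe_restrict_apply, hB, hT, Submodule.coe_smul, hB]
  have hinv : ∀ f, T' (T' f) = f := by
    intro f
    have : T' ∘ₗ T' = LinearMap.id := B.ext fun i => by
      rw [LinearMap.comp_apply, hT', map_smul, hT', smul_smul, hs, hσ, one_smul,
        LinearMap.id_apply]
    exact LinearMap.congr_fun this f
  -- The averaging projection onto the fixed space; the dimension of its image is its trace.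
  let P : S →ₗ[ℂ] S := (1 / 2 : ℂ) • (LinearMap.id + T')
  have hP : LinearMap.IsProj (N.comap S.subtype) P := by
    constructor
    · intro f
      rw [Submodule.mem_comap, hN]
      refine ⟨(P f).2, ?_⟩
      have : T' (P f) = P f := by
        simp only [P, LinearMap.smul_apply, LinearMap.add_apply, LinearMap.id_apply, map_smul,
          map_add, hinv]
        rw [add_comm]
      exact congrArg Subtype.val this
    · intro f hf
      rw [Submodule.mem_comap, hN] at hf
      have : T' f = f := Subtype.ext hf.2
      simp only [P, LinearMap.smul_apply, LinearMap.add_apply, LinearMap.id_apply, this]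
      rw [← two_smul ℂ f, smul_smul]
      norm_num
  have htr := hP.trace
  rw [LinearMap.trace_eq_matrix_trace ℂ B, (Submodule.comapSubtypeEquivOfLe
    (show N ≤ S from fun f hf => ((hN f).mp hf).1)).finrank_eq] at htr
  rw [← htr, Matrix.trace, Finset.mul_sum, Fintype.card_eq_sum_ones, Nat.cast_sum,
    ← Finset.sum_add_distrib]
  refine Finset.sum_congr rfl fun i _ => ?_
  rw [Matrix.diag_apply, LinearMap.toMatrix_apply]
  simp only [P, LinearMap.smul_apply, LinearMap.add_apply, LinearMap.id_apply, hT', map_smul,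
    map_add, Finsupp.smul_apply, Finsupp.add_apply, Module.Basis.repr_self, Finsupp.single_apply,
    smul_eq_mul]
  split_ifs <;> simp

/-- `J` sends `x₀ ↦ -x₁`, `x₁ ↦ x₀`, acts on the `p` in the same way, and has determinant one. -/
lemma translation_J_pluckerMon (k a₀ a₁ a₂ b₀ b₁ b₂ : ℕ) :
    translation 3 J (pluckerMon k a₀ a₁ a₂ b₀ b₁ b₂) =
      (-1 : ℂ) ^ (a₀ + b₀) • pluckerMon k a₁ a₀ a₂ b₁ b₀ b₂ := by
  have h : translation 3 J (pluckerMon k a₀ a₁ a₂ b₀ b₁ b₂) =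
      translate !![0, 1, 0; -1, 0, 0; 0, 0, 1] (pluckerMon k a₀ a₁ a₂ b₀ b₁ b₂) := rfl
  have hd : Matrix.det (!![0, 1, 0; -1, 0, 0; 0, 0, 1] : Matrix (Fin 3) (Fin 3) ℂ) = 1 := by
    rw [Matrix.det_fin_three]
    simp
  rw [h]
  simp only [pluckerMon, map_mul, map_pow, translate_genericDet, translate_rowVar,
    translate_minorVar, hd, Matrix.adjugate_fin_three, Fin.sum_univ_three, smul_eq_C_mul]
  simp [neg_pow (rowVar 1), neg_pow (minorVar 1), pow_add]
  ring

lemma forall_H3_iff (f : MvPolynomial (Fin 3 × Fin 3) ℂ) :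
    (∀ u ∈ H3, translation 3 u f = f) ↔
      (∀ u ∈ U1, translation 3 u f = f) ∧ translation 3 J f = f := by
  constructor
  · exact fun h => ⟨fun u hu => h u (Subgroup.subset_closure (Or.inl hu)),
      h J (Subgroup.subset_closure (Or.inr rfl))⟩
  · rintro ⟨h1, h2⟩ u hu
    induction hu using Subgroup.closure_induction with
    | mem x hx =>
      rcases hx with hx | rfl
      · exact h1 x hx
      · exact h2
    | one => rw [map_one, Module.End.one_apply]
    | mul x y _ _ hx hy => rw [map_mul, Module.End.mul_apply, hy, hx]
    | inv x _ hx =>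
      conv_lhs => rw [← hx]
      rw [← Module.End.mul_apply, ← map_mul, inv_mul_cancel, map_one, Module.End.one_apply]

/-- The exchange of the first two coordinates. -/
def swapExp (q : ℕ × ℕ × ℕ × ℕ) : ℕ × ℕ × ℕ × ℕ := (q.2.1, q.1, q.2.2.2, q.2.2.1)

lemma swapExp_mem {z b : ℕ} {q : ℕ × ℕ × ℕ × ℕ} (hq : q ∈ stdZero z b) :
    swapExp q ∈ stdZero z b := by
  simp only [stdZero, Finset.mem_filter, mem_std, swapExp] at hq ⊢
  omega

lemma two_mul_trivialMultiplicity_H3 {a b : ℕ} (h : b ≤ a) (k : ℕ) :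
    2 * (trivialMultiplicity ![a + k, b + k, k] H3 : ℤ) = (stdZero (a - b) b).card +
      ∑ q ∈ stdZero (a - b) b, if swapExp q = q then (-1) ^ (q.1 + q.2.2.1) else 0 := by
  set z := a - b with hz
  let S := Submodule.span ℂ (Set.range fun q : stdZero z b => stdMon z b k q)
  let N : Submodule ℂ (MvPolynomial (Fin 3 × Fin 3) ℂ) :=
    S ⊓ LinearMap.eqLocus (translation 3 J) LinearMap.id
  have hN : ∀ f, f ∈ N ↔ f ∈ S ∧ translation 3 J f = f := fun f => Iff.rfl
  rw [trivialMultiplicity_eq_finrank h k H3 N fun f => by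
    rw [hN, mem_span_stdZero_iff, forall_H3_iff, and_assoc]]
  have key := two_mul_finrank_fixed (linearIndependent_stdZero z b k)
    (σ := fun q => ⟨swapExp q, swapExp_mem q.2⟩) (fun q => rfl)
    (s := fun q => (-1) ^ (q.1.1 + q.1.2.2.1)) (fun q => ?_) (T := translation 3 J) (fun q => ?_)
    N hN
  · rw [Fintype.card_coe] at key
    simp only [Subtype.ext_iff] at key
    rw [Finset.sum_coe_sort (stdZero z b)
      (fun q => if swapExp q = q then (-1 : ℂ) ^ (q.1 + q.2.2.1) else 0)] at key
    exact_mod_cast key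
  · have hq := q.2
    simp only [stdZero, Finset.mem_filter, mem_std] at hq
    simp only [swapExp]
    rw [← pow_add]
    -- Weight zero makes the total exponent even; this reflects that `J²` lies in `U(1)`.
    exact Even.neg_one_pow ⟨q.1.1 + q.1.2.2.2, by omega⟩
  · simp only [stdMon, swapExp, translation_J_pluckerMon]
    rw [Nat.sub_right_comm z, Nat.sub_right_comm b]

/-! ### Counting -/

lemma card_even_pairs (z b : ℕ) :
    2 * ((Finset.range z ×ˢ Finset.range b).filter fun q => (q.1 + q.2) % 2 = 0).card =
      z * b + (z % 2) * (b % 2) := by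
  -- Rows of a checkerboard: `b / 2` rounded up for even `i`, rounded down for odd `i`.
  have h1 : ∀ i, ∑ j ∈ Finset.range b, (if (i + j) % 2 = 0 then 1 else 0) =
      (b + 1 - i % 2) / 2 := by
    intro i
    induction b with
    | zero => simp only [Finset.range_zero, Finset.sum_empty]; omega
    | succ b ih => rw [Finset.sum_range_succ, ih]; split_ifs <;> omega
  rw [Finset.card_filter, Finset.sum_product]
  simp only [h1]
  induction z with
  | zero => simp
  | succ z ih =>
    rw [Finset.sum_range_succ, mul_add, ih, add_mul, one_mul]
    rcases Nat.mod_two_eq_zero_or_one z with hz | hz <;>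
      rcases Nat.mod_two_eq_zero_or_one b with hb | hb <;>
      simp only [hz, hb, Nat.add_mod z 1 2] <;> omega

/-- Subtracting `min a₁ b₁` from both `a₀ + a₁` and `b₀ + b₁` leaves a pair `(i, j)` with `i - j =
2(a₁ - b₁)`. The subtracted amount is recovered as `min (z - i) (b - j)`, since one degree is
exhausted. -/
lemma card_stdZero_eq (z b : ℕ) :
    (stdZero z b).card =
      ((Finset.range (z + 1) ×ˢ Finset.range (b + 1)).filter fun q =>
        (q.1 + q.2) % 2 = 0).card := by
  refine Finset.card_nbij'
    (fun q => (q.1 + q.2.1 - min q.2.1 q.2.2.2, q.2.2.1 + q.2.2.2 - min q.2.1 q.2.2.2))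
    (fun q => (q.1 - (q.1 - q.2) / 2, min (z - q.1) (b - q.2) + (q.1 - q.2) / 2,
      q.2 - (q.2 - q.1) / 2, min (z - q.1) (b - q.2) + (q.2 - q.1) / 2)) ?_ ?_ ?_ ?_
  all_goals
    intro q hq
    simp only [stdZero, Finset.coe_filter, Set.mem_ofPred_eq, mem_std, Finset.mem_product,
      Finset.mem_range, Prod.ext_iff] at hq ⊢
    omega

lemma card_stdZero (z b : ℕ) :
    (stdZero z b).card = ⌈((z : ℚ) + 1) * ((b : ℚ) + 1) / 2⌉₊ := by
  have h := card_even_pairs (z + 1) (b + 1)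
  rw [← card_stdZero_eq] at h
  have h1 : (z + 1) % 2 * ((b + 1) % 2) ≤ 1 := by
    rcases Nat.mod_two_eq_zero_or_one (z + 1) with hz | hz <;>
      rcases Nat.mod_two_eq_zero_or_one (b + 1) with hb | hb <;> simp [hz, hb]
  have h2 : (2 : ℚ) * (stdZero z b).card =
      (z + 1) * (b + 1) + (((z + 1) % 2 * ((b + 1) % 2) : ℕ) : ℚ) := by exact_mod_cast h
  have h3 : (((z + 1) % 2 * ((b + 1) % 2) : ℕ) : ℚ) ≤ 1 := by exact_mod_cast h1
  have h4 : (0 : ℚ) ≤ (((z + 1) % 2 * ((b + 1) % 2) : ℕ) : ℚ) := Nat.cast_nonneg _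
  have h5 : 0 < (stdZero z b).card := by
    have : 0 < (z + 1) * (b + 1) := by positivity
    omega
  rw [eq_comm, Nat.ceil_eq_iff h5.ne', Nat.cast_sub h5]
  constructor <;> push_cast <;> linarith

/-! ### The trace of `J` on the vectors of weight zero -/

lemma sum_chi_range (z : ℕ) :
    ∑ i ∈ Finset.range (z / 2 + 1), (if 2 * i = z then (-1 : ℤ) ^ i else 0) = chi z := by
  obtain ⟨k, rfl | rfl⟩ := Nat.even_or_odd' z
  · rw [Finset.sum_eq_single_of_mem k (Finset.mem_range.mpr (by omega))
      (fun i _ hi => if_neg (by omega)), if_pos rfl, chi]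
    obtain ⟨l, rfl | rfl⟩ := Nat.even_or_odd' k
    · rw [if_pos (by omega)]; simp [pow_mul]
    · rw [if_neg (by omega), if_pos (by omega)]; simp [pow_mul, pow_add]
  · rw [chi, if_neg (by omega), if_neg (by omega)]
    exact Finset.sum_eq_zero fun i _ => if_neg (by omega)

lemma sum_neg_one_range (z : ℕ) :
    ∑ i ∈ Finset.range (z / 2 + 1), (-1 : ℤ) ^ i = if z % 4 < 2 then 1 else 0 := by
  rw [neg_one_geom_sum]
  simp only [Nat.even_iff]
  split_ifs <;> omega

lemma tau_eq_chi (z b : ℕ) :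
    tau z b = chi z * (if b % 4 < 2 then 1 else 0) + (if z % 4 < 2 then 1 else 0) * chi b -
      chi z * chi b := by
  have hchi : ∀ n, chi (n + 4) = chi n := fun n => by simp [chi]
  refine eq_of_add_four (f := fun z => tau z b) (g := fun z =>
    chi z * (if b % 4 < 2 then 1 else 0) + (if z % 4 < 2 then 1 else 0) * chi b - chi z * chi b)
    (fun n => tau_add_four_left n b) (fun n => by simp [hchi]) (fun z hz => ?_) z
  refine eq_of_add_four (f := fun b => tau z b) (g := fun b =>
    chi z * (if b % 4 < 2 then 1 else 0) + (if z % 4 < 2 then 1 else 0) * chi b - chi z * chi b)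
    (fun n => tau_add_four_right z n) (fun n => by simp [hchi]) (fun b hb => ?_) b
  interval_cases z <;> interval_cases b <;> decide

/-- Fixed monomials have exponents `(r, r, s, s)`, and standardness reads `2r = z` or `2s = b`.
Inclusion-exclusion splits the signed sum into products of one-variable sums, matched with the table
by `tau_eq_chi`. -/
lemma sum_fixed_stdZero (z b : ℕ) :
    ∑ q ∈ stdZero z b, (if swapExp q = q then (-1 : ℤ) ^ (q.1 + q.2.2.1) else 0) = tau z b := by
  have h1 : ∑ q ∈ stdZero z b, (if swapExp q = q then (-1 : ℤ) ^ (q.1 + q.2.2.1) else 0) =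
      ∑ r ∈ Finset.range (z / 2 + 1) ×ˢ Finset.range (b / 2 + 1),
        if 2 * r.1 = z ∨ 2 * r.2 = b then (-1 : ℤ) ^ (r.1 + r.2) else 0 := by
    rw [← Finset.sum_filter, ← Finset.sum_filter]
    refine Finset.sum_bij' (fun q _ => (q.1, q.2.2.1)) (fun r _ => (r.1, r.1, r.2, r.2))
      ?_ ?_ ?_ ?_ (fun _ _ => rfl)
    all_goals
      intro q hq
      simp only [stdZero, swapExp, mem_std, Finset.mem_filter, Finset.mem_product,
        Finset.mem_range, Prod.ext_iff, and_true, true_and] at hq ⊢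
    any_goals omega
  have h2 : ∀ r : ℕ × ℕ, (if 2 * r.1 = z ∨ 2 * r.2 = b then (-1 : ℤ) ^ (r.1 + r.2) else 0) =
      (if 2 * r.1 = z then (-1 : ℤ) ^ r.1 else 0) * (-1) ^ r.2 +
      (-1) ^ r.1 * (if 2 * r.2 = b then (-1 : ℤ) ^ r.2 else 0) -
      (if 2 * r.1 = z then (-1 : ℤ) ^ r.1 else 0) *
        (if 2 * r.2 = b then (-1 : ℤ) ^ r.2 else 0) := by
    intro r
    by_cases h : 2 * r.1 = z <;> by_cases h' : 2 * r.2 = b <;> simp [h, h', pow_add]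
  rw [h1, Finset.sum_congr rfl fun r _ => h2 r, Finset.sum_sub_distrib, Finset.sum_add_distrib]
  simp only [Finset.sum_product, ← Finset.mul_sum, ← Finset.sum_mul]
  rw [sum_chi_range, sum_chi_range, sum_neg_one_range, sum_neg_one_range, tau_eq_chi]

end SchurBranching

open SchurBranching in
theorem theorem4p6 :
    (∀ a b k : ℕ, b ≤ a →
      trivialMultiplicity ![a + k, b + k, k] U1
          = ⌈(((a - b : ℕ) : ℚ) + 1) * ((b : ℚ) + 1) / 2⌉₊ ∧
      (trivialMultiplicity ![a + k, b + k, k] H3 : ℚ)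
          = 1 / 2 * ((⌈(((a - b : ℕ) : ℚ) + 1) * ((b : ℚ) + 1) / 2⌉₊ : ℚ)
              + (tau (a - b) b : ℚ))) ∧
    (∀ m : ℕ, 1 ≤ m →
      (∏ i : Fin m, (1 + MvPolynomial.X i) * (1 + MvPolynomial.X i ^ 2)
          = ∑ lam ∈ boxPartitions 3 m,
              MvPolynomial.C (tau (partCount lam 1) (partCount lam 2)) * schur m lam) ∧
      (∏ i : Fin m, (1 - MvPolynomial.X i) * (1 + MvPolynomial.X i ^ 2)
          = ∑ lam ∈ boxPartitions 3 m,
              MvPolynomial.C ((-1) ^ (∑ i, lam i) * tau (partCount lam 1) (partCount lam 2))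
                * schur m lam)) := by
  refine ⟨fun a b k h => ⟨?_, ?_⟩, fun m _ => ⟨prod_eq_sum_schur m, prod_eq_sum_schur_neg m⟩⟩
  · rw [trivialMultiplicity_U1 h, card_stdZero]
  · have h1 := two_mul_trivialMultiplicity_H3 h k
    rw [sum_fixed_stdZero] at h1
    have h2 : (2 : ℚ) * trivialMultiplicity ![a + k, b + k, k] H3 =
        (stdZero (a - b) b).card + tau (a - b) b := by exact_mod_cast h1
    rw [← card_stdZero]
    linarith
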